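/- Let $\mathbb K\in\{\mathbb R,\mathbb C\}$ and let $\Gamma=(V,E,a,b,\gamma_0,\gamma_1)$ be a metric graph: $V$ (vertices) and $E$ (edges) are arbitrary sets (possibly uncountable, with vertices of infinite degree allowed), $a,b\colon E\to[-\infty,\infty]$ satisfy $a_e<b_e$ for all $e\in E$, the interval $(a_e,b_e)\subseteq\mathbb R$ corresponds to the edge $e$, and $\gamma_0\colon E_l:=\{e: a_e>-\infty\}\to V$ and $\gamma_1\colon E_r:=\{e: b_e<\infty\}\to V$ assign starting and end vertices. Assume that the edge lengths have a positive lower bound, $\inf_{e\in E}(b_e-a_e)>0$. Let $\mathcal H:=\bigoplus_{e\in E}L_2(a_e,b_e)$ (Hilbert space direct sum). For $k\in\{1,2\}$ let $\bigoplus_{e\in E}W_2^k(a_e,b_e)$ be the space of all $f=(f_e)_{e\in E}\in\mathcal H$ whose edgewise weak derivatives up to order $k$ exist and again form elements of $\mathcal H$, and write $f'=(f_e')_{e\in E}$. Let $E':=(E_l\times\{0\})\cup(E_r\times\{1\})$ be the set of finite boundary points of all edges. The trace and the signed trace are the linear maps $\operatorname{tr},\operatorname{str}\colon\bigoplus_{e\in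 E}W_2^1(a_e,b_e)\to\ell_2(E')$, $$(\operatorname{tr}f)(e,0)=f_e(a_e),\quad(\operatorname{tr}f)(e,1)=f_e(b_e),\qquad(\operatorname{str}f)(e,0)=f_e(a_e),\quad(\operatorname{str}f)(e,1)=-f_e(b_e),$$ where the boundary values are those of the continuous representatives. Let $\hat H$ be the maximal Laplacian in $\mathcal H$, $D(\hat H):=\bigoplus_{e\in E}W_2^2(a_e,b_e)$, $\hat Hf:=(-f_e'')_{e\in E}$. **Theorem.** A linear operator $H\subseteq\hat H$ (a restriction of $\hat H$ to a linear subspace of $D(\hat H)$) is self-adjoint in $\mathcal H$ if and only if there exist a closed subspace $X\subseteq\ell_2(E')$ and a (possibly unbounded) self-adjoint operator $L$ in $X$ such that $$D(H)=\{f\in D(\hat H):\ \operatorname{tr}f\in D(L),\ L\operatorname{tr}f=Q\operatorname{str}f'\},$$ where $Q\colon\ell_2(E')\to X$ is the orthogonal projection. No semiboundedness of $H$ or $L$ is assumed. -/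

import Mathlib

namespace QuantumGraph

open MeasureTheory Set
open scoped ENNReal ContDiff

section Edge
variable {𝕜 : Type*} [RCLike 𝕜] {I : Set ℝ}

/-- `g ∈ L₂(I)` is the weak (distributional) derivative of `f ∈ L₂(I)` on the open set `I ⊆ ℝ`:
`∫ f φ' = -∫ g φ` for every test function `φ ∈ C_c^∞(I)`. -/
def IsWeakDeriv (I : Set ℝ) (f g : Lp 𝕜 2 (volume.restrict I)) : Prop :=
  ∀ φ : ℝ → ℝ, ContDiff ℝ ∞ φ → HasCompactSupport φ → tsupport φ ⊆ I →
    ∫ x in I, deriv φ x • f x = -∫ x in I, φ x • g x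

open Classical in
/-- The value at `x ∈ closure I` of the representative of `f` that is continuous on `closure I`.
Such a representative exists if `I` is an open interval and `f ∈ W_2^1(I)` (see
`IsWeakDeriv.exists_continuous`), and its value is unique (see `boundaryValue_eq`);
the value `0` is assigned if there is none. -/
noncomputable def boundaryValue (I : Set ℝ) (f : Lp 𝕜 2 (volume.restrict I)) (x : ℝ) : 𝕜 :=
  if h : ∃ F : ℝ → 𝕜, ContinuousOn F (closure I) ∧ F =ᵐ[volume.restrict I] f then h.choose x else 0

theorem boundaryValue_eq (hI : IsOpen I) {f : Lp 𝕜 2 (volume.restrict I)} {F : ℝ → 𝕜}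
    (hF : ContinuousOn F (closure I)) (hf : F =ᵐ[volume.restrict I] f) {x : ℝ}
    (hx : x ∈ closure I) : boundaryValue I f x = F x := by
  have h : ∃ F : ℝ → 𝕜, ContinuousOn F (closure I) ∧ F =ᵐ[volume.restrict I] f := ⟨F, hF, hf⟩
  rw [boundaryValue, dif_pos h]
  have h1 := Measure.eqOn_open_of_ae_eq (h.choose_spec.2.trans hf.symm) hI
    (h.choose_spec.1.mono subset_closure) (hF.mono subset_closure)
  exact h1.of_subset_closure h.choose_spec.1 hF subset_closure subset_rfl hx

theorem integrable_test_smul {φ : ℝ → ℝ} (hφ : Continuous φ) (hc : HasCompactSupport φ)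
    (f : Lp 𝕜 2 (volume.restrict I)) :
    Integrable (fun x => φ x • f x) (volume.restrict I) := by
  have h1 : MemLp φ 2 (volume.restrict I) := (hφ.memLp_of_hasCompactSupport hc).restrict I
  exact memLp_one_iff_integrable.1 ((Lp.memLp f).smul (p := 2) (q := 2) (r := 1) h1)

theorem IsWeakDeriv.add {f g f' g' : Lp 𝕜 2 (volume.restrict I)} (h : IsWeakDeriv I f g)
    (h' : IsWeakDeriv I f' g') : IsWeakDeriv I (f + f') (g + g') := by
  intro φ h1 h2 h3
  have hd : Continuous (deriv φ) := h1.continuous_deriv (by simp)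
  have e1 : ∫ x in I, deriv φ x • (f + f') x
      = ∫ x in I, (deriv φ x • f x + deriv φ x • f' x) := by
    refine integral_congr_ae ?_
    filter_upwards [Lp.coeFn_add f f'] with x hx
    rw [hx, Pi.add_apply, smul_add]
  have e2 : ∫ x in I, φ x • (g + g') x = ∫ x in I, (φ x • g x + φ x • g' x) := by
    refine integral_congr_ae ?_
    filter_upwards [Lp.coeFn_add g g'] with x hx
    rw [hx, Pi.add_apply, smul_add]
  rw [e1, e2, integral_add (integrable_test_smul hd h2.deriv f)
    (integrable_test_smul hd h2.deriv f'), integral_add (integrable_test_smul h1.continuous h2 g)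
    (integrable_test_smul h1.continuous h2 g'), h φ h1 h2 h3, h' φ h1 h2 h3]
  ring

theorem IsWeakDeriv.smul {f g : Lp 𝕜 2 (volume.restrict I)} (c : 𝕜) (h : IsWeakDeriv I f g) :
    IsWeakDeriv I (c • f) (c • g) := by
  intro φ h1 h2 h3
  have e1 : ∫ x in I, deriv φ x • (c • f) x = ∫ x in I, c • (deriv φ x • f x) := by
    refine integral_congr_ae ?_
    filter_upwards [Lp.coeFn_smul c f] with x hx
    rw [hx, Pi.smul_apply, smul_comm]
  have e2 : ∫ x in I, φ x • (c • g) x = ∫ x in I, c • (φ x • g x) := by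
    refine integral_congr_ae ?_
    filter_upwards [Lp.coeFn_smul c g] with x hx
    rw [hx, Pi.smul_apply, smul_comm]
  rw [e1, e2, integral_smul, integral_smul, h φ h1 h2 h3, smul_neg]

theorem locInt (f : Lp 𝕜 2 (volume.restrict I)) (hI : MeasurableSet I) :
    LocallyIntegrable (I.indicator f) volume :=
  ((memLp_indicator_iff_restrict hI).2 (Lp.memLp f)).locallyIntegrable (by norm_num)

theorem IsWeakDeriv.unique (hI : IsOpen I) {f g g' : Lp 𝕜 2 (volume.restrict I)}
    (h : IsWeakDeriv I f g) (h' : IsWeakDeriv I f g') : g = g' := by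
  have key := hI.ae_eq_zero_of_integral_contDiff_smul_eq_zero (μ := volume)
    (f := I.indicator (g - g' : Lp 𝕜 2 (volume.restrict I)))
    ((locInt _ hI.measurableSet).locallyIntegrableOn I) (fun φ h1 h2 h3 => by
      have e : ∀ x, φ x • I.indicator (g - g' : Lp 𝕜 2 (volume.restrict I)) x
          = I.indicator (fun x => φ x • (g - g' : Lp 𝕜 2 (volume.restrict I)) x) x := by
        intro x; by_cases hx : x ∈ I <;> simp [hx]
      simp_rw [e]
      rw [integral_indicator hI.measurableSet]
      have e2 : ∫ x in I, φ x • (g - g' : Lp 𝕜 2 (volume.restrict I)) x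
          = ∫ x in I, (φ x • g x - φ x • g' x) := by
        refine integral_congr_ae ?_
        filter_upwards [Lp.coeFn_sub g g'] with x hx
        rw [hx, Pi.sub_apply, smul_sub]
      rw [e2, integral_sub (integrable_test_smul h1.continuous h2 g)
        (integrable_test_smul h1.continuous h2 g')]
      have := (h φ h1 h2 h3).symm.trans (h' φ h1 h2 h3)
      rw [neg_inj.1 this, sub_self])
  apply sub_eq_zero.1
  refine (Lp.eq_zero_iff_ae_eq_zero).2 ?_
  rw [Filter.EventuallyEq, ae_restrict_iff' hI.measurableSet]
  filter_upwards [key] with x hx hxI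
  simpa [hxI] using hx hxI

theorem by_parts_real {g : ℝ → ℝ} (hg : LocallyIntegrable g volume) {φ : ℝ → ℝ}
    (h1 : ContDiff ℝ ∞ φ) (h2 : HasCompactSupport φ) :
    ∫ x, deriv φ x * (∫ t in (0 : ℝ)..x, g t) = -∫ x, φ x * g x := by
  obtain ⟨R, hR, hsub⟩ : ∃ R : ℝ, 0 < R ∧ tsupport φ ⊆ Ioo (-R) R := by
    obtain ⟨r, hr⟩ := h2.isCompact.isBounded.subset_ball (0 : ℝ)
    refine ⟨max r 1, by positivity, hr.trans ?_⟩
    rw [Real.ball_eq_Ioo]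
    exact Ioo_subset_Ioo (by have := le_max_left r 1; linarith) (by simp)
  have hle : -R ≤ R := by linarith
  have hgi : ∀ a b : ℝ, IntervalIntegrable g volume a b := fun a b =>
    (hg.integrableOn_isCompact isCompact_uIcc).intervalIntegrable
  have acF : AbsolutelyContinuousOnInterval (fun x => ∫ t in (0 : ℝ)..x, g t) (-R) R :=
    (hgi _ _).absolutelyContinuousOnInterval_intervalIntegral
      (by rw [uIcc_of_le hle]; constructor <;> linarith)
  have acφ : AbsolutelyContinuousOnInterval φ (-R) R :=
    (h1.of_le (by simp)).contDiffOn.absolutelyContinuousOnInterval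
  have zR : φ R = 0 := image_eq_zero_of_notMem_tsupport fun h => absurd (hsub h).2 (lt_irrefl _)
  have zR' : φ (-R) = 0 :=
    image_eq_zero_of_notMem_tsupport fun h => absurd (hsub h).1 (lt_irrefl _)
  have key := acφ.integral_mul_deriv_eq_deriv_mul acF
  rw [zR, zR'] at key
  have e1 : ∫ x in (-R)..R, φ x * deriv (fun x => ∫ t in (0 : ℝ)..x, g t) x
      = ∫ x in (-R)..R, φ x * g x := by
    apply intervalIntegral.integral_congr_ae
    filter_upwards [(hgi (-R) R).ae_hasDerivAt_integral] with x hx hx'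
    rw [(hx (uIoc_subset_uIcc hx') 0
      (by rw [uIcc_of_le hle]; constructor <;> linarith)).deriv]
  rw [e1] at key
  have s1 : ∫ x in (-R)..R, φ x * g x = ∫ x, φ x * g x := by
    apply intervalIntegral.integral_eq_integral_of_support_subset
    intro x hx
    have : x ∈ tsupport φ := subset_tsupport _ (left_ne_zero_of_mul hx)
    exact Ioo_subset_Ioc_self (hsub this)
  have s2 : ∫ x in (-R)..R, deriv φ x * (∫ t in (0 : ℝ)..x, g t)
      = ∫ x, deriv φ x * (∫ t in (0 : ℝ)..x, g t) := by
    apply intervalIntegral.integral_eq_integral_of_support_subset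
    intro x hx
    have : x ∈ tsupport φ := support_deriv_subset (left_ne_zero_of_mul hx)
    exact Ioo_subset_Ioc_self (hsub this)
  rw [s1, s2] at key
  linarith

theorem by_parts {g : ℝ → 𝕜} (hg : LocallyIntegrable g volume) {φ : ℝ → ℝ}
    (h1 : ContDiff ℝ ∞ φ) (h2 : HasCompactSupport φ) :
    ∫ x, deriv φ x • (∫ t in (0 : ℝ)..x, g t) = -∫ x, φ x • g x := by
  have hd : Continuous (deriv φ) := h1.continuous_deriv (by simp)
  have hgi : ∀ a b : ℝ, IntervalIntegrable g volume a b := fun a b =>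
    (hg.integrableOn_isCompact isCompact_uIcc).intervalIntegrable
  have hcF : Continuous (fun x => ∫ t in (0 : ℝ)..x, g t) :=
    intervalIntegral.continuous_primitive hgi 0
  have i1 : Integrable (fun x => deriv φ x • (∫ t in (0 : ℝ)..x, g t)) volume :=
    (hd.smul hcF).integrable_of_hasCompactSupport h2.deriv.smul_right
  have i2 : Integrable (fun x => φ x • g x) volume :=
    hg.integrable_smul_left_of_hasCompactSupport h1.continuous h2
  have main : ∀ A : 𝕜 →L[ℝ] ℝ, A (∫ x, deriv φ x • (∫ t in (0 : ℝ)..x, g t))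
      = A (-∫ x, φ x • g x) := by
    intro A
    have hA : LocallyIntegrable (fun x => A (g x)) volume := fun x => by
      obtain ⟨s, hs, hi⟩ := hg x
      exact ⟨s, hs, A.integrable_comp hi⟩
    rw [map_neg, ← A.integral_comp_comm i1, ← A.integral_comp_comm i2]
    have := by_parts_real hA h1 h2
    simp only [map_smul, smul_eq_mul]
    rw [← this]
    congr 1
    ext x
    rw [A.intervalIntegral_comp_comm (hgi 0 x)]
  exact RCLike.ext (main RCLike.reCLM) (main RCLike.imCLM)

theorem const_of_weak_deriv_zero (hI : IsOpen I) (hc : I.OrdConnected) (hne : I.Nonempty)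
    {u : ℝ → 𝕜} (hu : LocallyIntegrable u volume)
    (h : ∀ φ : ℝ → ℝ, ContDiff ℝ ∞ φ → HasCompactSupport φ → tsupport φ ⊆ I →
      ∫ x, deriv φ x • u x = 0) : ∃ C : 𝕜, ∀ᵐ x, x ∈ I → u x = C := by
  obtain ⟨x₀, hx₀⟩ := hne
  obtain ⟨ε, hε, hball⟩ := Metric.isOpen_iff.1 hI x₀ hx₀
  let B : ContDiffBump x₀ := ⟨ε / 4, ε / 2, by positivity, by linarith⟩
  let ψ : ℝ → ℝ := B.normed volume
  have ψ1 : ContDiff ℝ ∞ ψ := B.contDiff_normed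
  have ψ2 : HasCompactSupport ψ := B.hasCompactSupport_normed
  have ψ3 : tsupport ψ ⊆ I := by
    have e : tsupport ψ = Metric.closedBall x₀ (ε / 2) := B.tsupport_normed_eq
    rw [e]
    exact (Metric.closedBall_subset_ball (by linarith)).trans hball
  have ψ4 : ∫ x, ψ x = 1 := B.integral_normed
  refine ⟨∫ x, ψ x • u x, ?_⟩
  set C := ∫ x, ψ x • u x with hC
  have key := hI.ae_eq_zero_of_integral_contDiff_smul_eq_zero (μ := volume)
    (f := fun x => u x - C)
    ((hu.sub (locallyIntegrable_const C)).locallyIntegrableOn I) (fun φ h1 h2 h3 => by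
      let c : ℝ := ∫ x, φ x
      let θ : ℝ → ℝ := fun x => φ x - c * ψ x
      have θ1 : ContDiff ℝ ∞ θ := h1.sub (contDiff_const.mul ψ1)
      have θcont := θ1.continuous
      have θ2 : HasCompactSupport θ := h2.sub ψ2.mul_left
      have iφ : Integrable φ volume := h1.continuous.integrable_of_hasCompactSupport h2
      have iψ : Integrable ψ volume := ψ1.continuous.integrable_of_hasCompactSupport ψ2
      have θ0 : ∫ x, θ x = 0 := by
        change ∫ x, (φ x - c * ψ x) = 0
        rw [integral_sub iφ (iψ.const_mul c), integral_const_mul, ψ4]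
        simp [c]
      obtain ⟨A, D, hAI, hDI, hAD⟩ : ∃ A D, A ∈ I ∧ D ∈ I ∧
          Function.support θ ⊆ Ioc A D := by
        have hK : IsCompact (tsupport φ ∪ tsupport ψ) := h2.isCompact.union ψ2.isCompact
        have hKI : tsupport φ ∪ tsupport ψ ⊆ I := union_subset h3 ψ3
        have hKn : (tsupport φ ∪ tsupport ψ).Nonempty := by
          refine Nonempty.inr ?_
          have e : tsupport ψ = Metric.closedBall x₀ (ε / 2) := B.tsupport_normed_eq
          rw [e]
          exact ⟨x₀, Metric.mem_closedBall_self (by positivity)⟩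
        have hA := hK.sInf_mem hKn
        have hD := hK.sSup_mem hKn
        obtain ⟨δ, hδ, hb⟩ := Metric.isOpen_iff.1 hI _ (hKI hA)
        refine ⟨sInf (tsupport φ ∪ tsupport ψ) - δ / 2, _, hb ?_, hKI hD, ?_⟩
        · rw [Real.ball_eq_Ioo]; constructor <;> linarith
        · intro x hx
          have hxK : x ∈ tsupport φ ∪ tsupport ψ := by
            by_contra hn
            rw [mem_union, not_or] at hn
            exact hx (by simp [θ, image_eq_zero_of_notMem_tsupport hn.1,
              image_eq_zero_of_notMem_tsupport hn.2])
          have a1 := csInf_le hK.bddBelow hxK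
          exact ⟨by linarith, le_csSup hK.bddAbove hxK⟩
      let Θ : ℝ → ℝ := fun x => ∫ t in A..x, θ t
      have Θd : ∀ x, HasDerivAt Θ (θ x) x := fun x =>
        intervalIntegral.integral_hasDerivAt_right (θcont.intervalIntegrable _ _)
          (θcont.stronglyMeasurableAtFilter _ _) θcont.continuousAt
      have Θde : deriv Θ = θ := funext fun x => (Θd x).deriv
      have Θ1 : ContDiff ℝ ∞ Θ := by
        rw [contDiff_infty_iff_deriv]
        exact ⟨fun x => (Θd x).differentiableAt, Θde ▸ θ1⟩
      have Θs : Function.support Θ ⊆ Icc A D := by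
        intro x hx
        by_contra hn
        apply hx
        rw [mem_Icc, not_and_or, not_le, not_le] at hn
        rcases hn with hn | hn
        · change ∫ t in A..x, θ t = 0
          rw [intervalIntegral.integral_symm, intervalIntegral.integral_of_le hn.le,
            setIntegral_eq_zero_of_forall_eq_zero, neg_zero]
          intro t ht
          by_contra h0
          exact absurd (hAD h0).1 (not_lt.2 ht.2)
        · change ∫ t in A..x, θ t = 0
          rw [intervalIntegral.integral_eq_integral_of_support_subset, θ0]
          exact hAD.trans (Ioc_subset_Ioc_right hn.le)
      have Θt : tsupport Θ ⊆ Icc A D := closure_minimal Θs isClosed_Icc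
      have Θ2 : HasCompactSupport Θ := isCompact_Icc.of_isClosed_subset (isClosed_tsupport _) Θt
      have hz := h Θ Θ1 Θ2 (Θt.trans (hc.out hAI hDI))
      rw [Θde] at hz
      have i1 : Integrable (fun x => φ x • u x) volume :=
        hu.integrable_smul_left_of_hasCompactSupport h1.continuous h2
      have i2 : Integrable (fun x => ψ x • u x) volume :=
        hu.integrable_smul_left_of_hasCompactSupport ψ1.continuous ψ2
      have e1 : ∫ x, θ x • u x = ∫ x, (φ x • u x - c • (ψ x • u x)) := by
        congr 1; ext x; simp only [θ, sub_smul, mul_smul]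
      have i2c : Integrable (fun x => c • (ψ x • u x)) volume := i2.smul c
      rw [e1, integral_sub i1 i2c, integral_smul, ← hC] at hz
      simp_rw [smul_sub]
      rw [integral_sub i1 (iφ.smul_const C), integral_smul_const]
      exact hz)
  filter_upwards [key] with x hx hxI
  exact sub_eq_zero.1 (hx hxI)

theorem IsWeakDeriv.exists_continuous (hI : IsOpen I) (hc : I.OrdConnected)
    {f g : Lp 𝕜 2 (volume.restrict I)} (h : IsWeakDeriv I f g) :
    ∃ F : ℝ → 𝕜, Continuous F ∧ F =ᵐ[volume.restrict I] f ∧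
      ∀ x y, F y - F x = ∫ t in x..y, I.indicator g t := by
  have hg := locInt g hI.measurableSet
  have hf := locInt f hI.measurableSet
  have hgi : ∀ a b : ℝ, IntervalIntegrable (I.indicator g) volume a b := fun a b =>
    (hg.integrableOn_isCompact isCompact_uIcc).intervalIntegrable
  let G : ℝ → 𝕜 := fun x => ∫ t in (0 : ℝ)..x, I.indicator g t
  have hG : Continuous G := intervalIntegral.continuous_primitive hgi 0
  rcases I.eq_empty_or_nonempty with he | hne
  · refine ⟨G, hG, ?_, fun x y => intervalIntegral.integral_interval_sub_left (hgi _ _) (hgi _ _)⟩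
    rw [Filter.EventuallyEq, ae_restrict_iff' hI.measurableSet]
    exact Filter.Eventually.of_forall fun x hx => absurd hx (by simp [he])
  obtain ⟨C, hC⟩ := const_of_weak_deriv_zero hI hc hne (hf.sub hG.locallyIntegrable)
    (fun φ h1 h2 h3 => by
      have hd : Continuous (deriv φ) := h1.continuous_deriv (by simp)
      have b := by_parts hg h1 h2
      have w := h φ h1 h2 h3
      have e : ∀ (χ : ℝ → ℝ) (k : Lp 𝕜 2 (volume.restrict I)),
          ∫ x, χ x • I.indicator k x = ∫ x in I, χ x • k x := by
        intro χ k
        rw [← integral_indicator hI.measurableSet]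
        congr 1; ext x; by_cases hx : x ∈ I <;> simp [hx]
      rw [e] at b
      rw [← e] at w
      simp only [Pi.sub_apply, smul_sub]
      rw [integral_sub (hf.integrable_smul_left_of_hasCompactSupport hd h2.deriv)
        (hG.locallyIntegrable.integrable_smul_left_of_hasCompactSupport hd h2.deriv), w, b,
        sub_self])
  refine ⟨fun x => G x + C, hG.add continuous_const, ?_, fun x y => ?_⟩
  · rw [Filter.EventuallyEq, ae_restrict_iff' hI.measurableSet]
    filter_upwards [hC] with x hx hxI
    have := hx hxI
    simp only [Pi.sub_apply, indicator_of_mem hxI] at this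
    rw [← this]; ring
  · rw [add_sub_add_right_eq_sub]
    exact intervalIntegral.integral_interval_sub_left (hgi _ _) (hgi _ _)

theorem norm_sq_eq (f : Lp 𝕜 2 (volume.restrict I)) :
    ‖f‖ ^ 2 = ∫ x in I, ‖f x‖ ^ 2 := by
  have h := L2.inner_def (𝕜 := 𝕜) f f
  rw [inner_self_eq_norm_sq_to_K] at h
  have e : ∀ x, inner 𝕜 (f x) (f x) = ((‖f x‖ ^ 2 : ℝ) : 𝕜) := fun x => by
    rw [inner_self_eq_norm_sq_to_K]; push_cast; rfl
  simp_rw [e] at h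
  rw [integral_ofReal] at h
  exact_mod_cast h

theorem norm_boundaryValue_sq_le (hI : IsOpen I) (hc : I.OrdConnected)
    {f g : Lp 𝕜 2 (volume.restrict I)} (h : IsWeakDeriv I f g) {p q : ℝ} (hpq : p < q)
    (hsub : Ioo p q ⊆ I) {z : ℝ} (hz : z ∈ Icc p q) :
    ‖boundaryValue I f z‖ ^ 2 ≤ 2 / (q - p) * ‖f‖ ^ 2 + 2 * (q - p) * ‖g‖ ^ 2 := by
  obtain ⟨F, hF, hFf, hFg⟩ := h.exists_continuous hI hc
  have hzI : z ∈ closure I := closure_mono hsub (by rwa [closure_Ioo hpq.ne])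
  rw [boundaryValue_eq hI hF.continuousOn hFf hzI]
  have hl : 0 < q - p := sub_pos.2 hpq
  have if2 : IntegrableOn (fun x => ‖f x‖ ^ 2) I volume := (Lp.memLp f).integrable_norm_pow (by simp)
  have ig2 : IntegrableOn (fun x => ‖g x‖ ^ 2) I volume := (Lp.memLp g).integrable_norm_pow (by simp)
  have hg := locInt g hI.measurableSet
  set N : ℝ := ∫ t in Ioo p q, ‖g t‖ with hN
  have igJ : MemLp g 2 (volume.restrict (Ioo p q)) :=
    (Lp.memLp g).mono_measure (Measure.restrict_mono hsub le_rfl)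
  have igN : Integrable (fun t => ‖g t‖) (volume.restrict (Ioo p q)) :=
    (igJ.integrable (by norm_num)).norm
  have hN2 : N ^ 2 ≤ (q - p) * ‖g‖ ^ 2 := by
    have hv : volume.real (Ioo p q) = q - p := by simp [Measure.real, hl.le]
    have igJ2 : Integrable (fun t => ‖g t‖ ^ 2) (volume.restrict (Ioo p q)) :=
      igJ.integrable_norm_pow (by simp)
    have hnn : 0 ≤ ∫ t in Ioo p q, (‖g t‖ - N / (q - p)) ^ 2 :=
      integral_nonneg fun t => sq_nonneg _
    have e : ∀ t, (‖g t‖ - N / (q - p)) ^ 2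
        = ‖g t‖ ^ 2 - (2 * (N / (q - p)) * ‖g t‖ - (N / (q - p)) ^ 2) := fun t => by ring
    simp_rw [e] at hnn
    have ic : Integrable (fun _ : ℝ => (N / (q - p)) ^ 2) (volume.restrict (Ioo p q)) :=
      integrable_const _
    have ims : Integrable (fun t => 2 * (N / (q - p)) * ‖g t‖ - (N / (q - p)) ^ 2)
        (volume.restrict (Ioo p q)) := (igN.const_mul _).sub ic
    rw [integral_sub igJ2 ims, integral_sub (igN.const_mul _) ic,
      integral_const_mul, integral_const, ← hN] at hnn
    simp only [MeasurableSet.univ, measureReal_restrict_apply, univ_inter, hv, smul_eq_mul] at hnn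
    have mono : ∫ t in Ioo p q, ‖g t‖ ^ 2 ≤ ‖g‖ ^ 2 := by
      rw [norm_sq_eq]
      exact setIntegral_mono_set ig2 (Filter.Eventually.of_forall fun t => by positivity)
        (LE.le.eventuallyLE hsub)
    have : (q - p) * (2 * (N / (q - p)) * N - (q - p) * (N / (q - p)) ^ 2) = N ^ 2 := by
      field_simp; ring
    nlinarith
  have pt : ∀ᵐ y ∂(volume.restrict (Ioo p q)), ‖F z‖ ^ 2 ≤ 2 * ‖f y‖ ^ 2 + 2 * N ^ 2 := by
    have hFJ : F =ᵐ[volume.restrict (Ioo p q)] f :=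
      hFf.filter_mono (ae_mono (Measure.restrict_mono hsub le_rfl))
    filter_upwards [hFJ, ae_restrict_mem measurableSet_Ioo] with y hy hyJ
    have hb : ‖F z - F y‖ ≤ N := by
      rw [hFg y z]
      have hsubI : uIoc y z ⊆ Ioc p q := by
        intro t ht
        rw [uIoc, mem_Ioc] at ht
        refine ⟨lt_of_le_of_lt (le_min hyJ.1.le hz.1) ht.1, ht.2.trans (max_le hyJ.2.le hz.2)⟩
      refine intervalIntegral.norm_integral_le_integral_norm_uIoc.trans ?_
      have e1 : N = ∫ t in Ioc p q, ‖I.indicator g t‖ := by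
        rw [integral_Ioc_eq_integral_Ioo]
        refine setIntegral_congr_fun measurableSet_Ioo fun t ht => ?_
        simp [hsub ht]
      rw [e1]
      refine setIntegral_mono_set ?_ (Filter.Eventually.of_forall fun t => norm_nonneg _)
        (LE.le.eventuallyLE hsubI)
      exact ((hg.integrableOn_isCompact isCompact_Icc).mono_set Ioc_subset_Icc_self).norm
    rw [← hy]
    have h1 : ‖F z‖ ≤ ‖F y‖ + N := by
      have := norm_add_le (F y) (F z - F y)
      rw [add_sub_cancel] at this
      linarith
    have h2 : ‖F z‖ ^ 2 ≤ (‖F y‖ + N) ^ 2 := by gcongr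
    nlinarith [sq_nonneg (‖F y‖ - N)]
  have hint : (q - p) * ‖F z‖ ^ 2 ≤ 2 * ‖f‖ ^ 2 + (q - p) * (2 * N ^ 2) := by
    have hv : volume.real (Ioo p q) = q - p := by simp [Measure.real, hl.le]
    have if2J := if2.mono_set hsub
    have ic : ∀ c : ℝ, Integrable (fun _ : ℝ => c) (volume.restrict (Ioo p q)) :=
      fun c => integrable_const c
    have := integral_mono_ae (ic (‖F z‖ ^ 2)) ((if2J.const_mul 2).add (ic (2 * N ^ 2))) pt
    simp only [Pi.add_apply] at this
    rw [integral_add (if2J.const_mul 2) (ic _), integral_const, integral_const,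
      integral_const_mul] at this
    simp only [MeasurableSet.univ, measureReal_restrict_apply, univ_inter, hv, smul_eq_mul] at this
    have mono : ∫ t in Ioo p q, ‖f t‖ ^ 2 ≤ ‖f‖ ^ 2 := by
      rw [norm_sq_eq]
      exact setIntegral_mono_set if2 (Filter.Eventually.of_forall fun t => by positivity)
        (LE.le.eventuallyLE hsub)
    linarith
  have e2 : 2 / (q - p) * ‖f‖ ^ 2 + 2 * (q - p) * ‖g‖ ^ 2
      = (2 * ‖f‖ ^ 2 + (q - p) * (2 * ((q - p) * ‖g‖ ^ 2))) / (q - p) := by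
    field_simp
  rw [e2, le_div_iff₀ hl]
  nlinarith [mul_le_mul_of_nonneg_left hN2 hl.le]

theorem boundaryValue_add (hI : IsOpen I) (hc : I.OrdConnected)
    {f g f' g' : Lp 𝕜 2 (volume.restrict I)} (hf : IsWeakDeriv I f f') (hg : IsWeakDeriv I g g')
    {z : ℝ} (hz : z ∈ closure I) :
    boundaryValue I (f + g) z = boundaryValue I f z + boundaryValue I g z := by
  obtain ⟨F, hF, hFf, -⟩ := hf.exists_continuous hI hc
  obtain ⟨G, hG, hGg, -⟩ := hg.exists_continuous hI hc
  rw [boundaryValue_eq hI hF.continuousOn hFf hz, boundaryValue_eq hI hG.continuousOn hGg hz]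
  refine boundaryValue_eq (F := fun x => F x + G x) hI (hF.add hG).continuousOn ?_ hz
  filter_upwards [hFf, hGg, Lp.coeFn_add f g] with x h1 h2 h3
  rw [h3, h1, h2, Pi.add_apply]

theorem boundaryValue_smul (hI : IsOpen I) (hc : I.OrdConnected) (c : 𝕜)
    {f f' : Lp 𝕜 2 (volume.restrict I)} (hf : IsWeakDeriv I f f') {z : ℝ} (hz : z ∈ closure I) :
    boundaryValue I (c • f) z = c * boundaryValue I f z := by
  obtain ⟨F, hF, hFf, -⟩ := hf.exists_continuous hI hc
  rw [boundaryValue_eq hI hF.continuousOn hFf hz]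
  refine boundaryValue_eq (F := fun x => c * F x) hI (hF.const_smul c).continuousOn ?_ hz
  filter_upwards [hFf, Lp.coeFn_smul c f] with x h1 h3
  rw [h3, h1, Pi.smul_apply, smul_eq_mul]

end Edge

/-- A metric graph with vertex set `V` and edge set `E` (both of arbitrary cardinality), as a
directed multigraph. The edge `e` is the interval `(a e, b e) ⊆ ℝ`, possibly unbounded.
Edges with `a e > -∞` have a starting vertex, edges with `b e < ∞` have an end vertex. -/
structure MetricGraph (V E : Type*) where
  a : E → EReal
  b : E → EReal
  a_lt_b : ∀ e, a e < b e
  γ₀ : {e : E // ⊥ < a e} → V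
  γ₁ : {e : E // b e < ⊤} → V

namespace MetricGraph

variable {V E : Type*} (Γ : MetricGraph V E) (𝕜 : Type*) [RCLike 𝕜]

/-- The open interval `(aₑ, bₑ) ⊆ ℝ`. -/
def edge (e : E) : Set ℝ := {x | Γ.a e < (x : EReal) ∧ (x : EReal) < Γ.b e}

theorem isOpen_edge (e : E) : IsOpen (Γ.edge e) :=
  (isOpen_lt continuous_const continuous_coe_real_ereal).inter
    (isOpen_lt continuous_coe_real_ereal continuous_const)

theorem ordConnected_edge (e : E) : (Γ.edge e).OrdConnected :=
  ⟨fun _ hx _ hy _ hz => ⟨hx.1.trans_le (EReal.coe_le_coe_iff.2 hz.1),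
    (EReal.coe_le_coe_iff.2 hz.2).trans_lt hy.2⟩⟩

/-- The Hilbert space direct sum `⨁ₑ L₂(aₑ, bₑ)`. -/
noncomputable abbrev Space := lp (fun e : E => Lp 𝕜 2 (volume.restrict (Γ.edge e))) 2

/-- The set `E'` of all finite boundary points of all edges: `Sum.inl e` is the left endpoint
`aₑ > -∞` of `e`, and `Sum.inr e` is the right endpoint `bₑ < ∞` of `e`. -/
abbrev Endpoint := {e : E // ⊥ < Γ.a e} ⊕ {e : E // Γ.b e < ⊤}

/-- The Hilbert space `ℓ₂(E')`. -/
noncomputable abbrev BoundarySpace := lp (fun _ : Γ.Endpoint => 𝕜) 2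

variable {𝕜}

/-- `f` is edgewise weakly differentiable with derivative `g`. -/
def HasWeakDeriv (f g : Γ.Space 𝕜) : Prop := ∀ e, IsWeakDeriv (Γ.edge e) (f e) (g e)

variable {Γ} in
theorem HasWeakDeriv.add {f g f' g' : Γ.Space 𝕜} (h : Γ.HasWeakDeriv f g)
    (h' : Γ.HasWeakDeriv f' g') : Γ.HasWeakDeriv (f + f') (g + g') :=
  fun e => (h e).add (h' e)

variable {Γ} in
theorem HasWeakDeriv.smul {f g : Γ.Space 𝕜} (c : 𝕜) (h : Γ.HasWeakDeriv f g) :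
    Γ.HasWeakDeriv (c • f) (c • g) :=
  fun e => (h e).smul c

variable {Γ} in
theorem HasWeakDeriv.unique {f g g' : Γ.Space 𝕜} (h : Γ.HasWeakDeriv f g)
    (h' : Γ.HasWeakDeriv f g') : g = g' :=
  lp.ext (funext fun e => (h e).unique (Γ.isOpen_edge e) (h' e))

variable (𝕜)

/-- `⨁ₑ W_2^1(aₑ, bₑ)`: the `f ∈ ⨁ₑ L₂(aₑ, bₑ)` that have an edgewise weak derivative in
`⨁ₑ L₂(aₑ, bₑ)`. -/
noncomputable def W1 : Submodule 𝕜 (Γ.Space 𝕜) where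
  carrier := {f | ∃ g, Γ.HasWeakDeriv f g}
  add_mem' := fun ⟨g, hg⟩ ⟨g', hg'⟩ => ⟨g + g', hg.add hg'⟩
  zero_mem' := ⟨0, fun e φ _ _ _ => by
    rw [show (0 : Γ.Space 𝕜) e = (0 : ℝ) • (0 : Lp 𝕜 2 (volume.restrict (Γ.edge e))) by simp]
    have h1 : ∀ χ : ℝ → ℝ, ∫ x in Γ.edge e, χ x •
        ((0 : ℝ) • (0 : Lp 𝕜 2 (volume.restrict (Γ.edge e)))) x = 0 := fun χ => by
      rw [zero_smul]
      refine integral_eq_zero_of_ae ?_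
      filter_upwards [Lp.coeFn_zero 𝕜 2 (volume.restrict (Γ.edge e))] with x hx
      rw [hx]; simp
    rw [h1, h1, neg_zero]⟩
  smul_mem' := fun c _ ⟨g, hg⟩ => ⟨c • g, hg.smul c⟩

variable {𝕜}

/-- `f ↦ f' = (fₑ')ₑ` on `⨁ₑ W_2^1(aₑ, bₑ)`. -/
noncomputable def weakDeriv : Γ.W1 𝕜 →ₗ[𝕜] Γ.Space 𝕜 where
  toFun f := f.2.choose
  map_add' f g := (f + g).2.choose_spec.unique (f.2.choose_spec.add g.2.choose_spec)
  map_smul' c f := (c • f).2.choose_spec.unique (f.2.choose_spec.smul c)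

theorem hasWeakDeriv_weakDeriv (f : Γ.W1 𝕜) : Γ.HasWeakDeriv f (Γ.weakDeriv f) :=
  f.2.choose_spec

variable (𝕜)

/-- `⨁ₑ W_2^2(aₑ, bₑ)`: the `f ∈ ⨁ₑ W_2^1(aₑ, bₑ)` with `f' ∈ ⨁ₑ W_2^1(aₑ, bₑ)`. -/
noncomputable def W2 : Submodule 𝕜 (Γ.Space 𝕜) :=
  ((Γ.W1 𝕜).comap Γ.weakDeriv).map (Γ.W1 𝕜).subtype

variable {𝕜}

/-- The inclusion of `⨁ₑ W_2^2(aₑ, bₑ)` in `⨁ₑ W_2^1(aₑ, bₑ)`. -/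
noncomputable def toW1 : Γ.W2 𝕜 →ₗ[𝕜] Γ.W1 𝕜 :=
  Submodule.inclusion (Submodule.map_subtype_le _ _)

theorem weakDeriv_toW1_mem (f : Γ.W2 𝕜) : Γ.weakDeriv (Γ.toW1 f) ∈ Γ.W1 𝕜 := by
  obtain ⟨_, g, hg, rfl⟩ := f
  exact hg

/-- `f ↦ f'` as a map from `⨁ₑ W_2^2(aₑ, bₑ)` to `⨁ₑ W_2^1(aₑ, bₑ)`. -/
noncomputable def firstDeriv : Γ.W2 𝕜 →ₗ[𝕜] Γ.W1 𝕜 :=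
  (Γ.weakDeriv ∘ₗ Γ.toW1).codRestrict (Γ.W1 𝕜) (Γ.weakDeriv_toW1_mem)

variable (𝕜)

/-- The maximal Laplacian: domain `⨁ₑ W_2^2(aₑ, bₑ)`, `f ↦ (-fₑ'')ₑ`. -/
noncomputable def maximalLaplacian : Γ.Space 𝕜 →ₗ.[𝕜] Γ.Space 𝕜 where
  domain := Γ.W2 𝕜
  toFun := -(Γ.weakDeriv ∘ₗ Γ.firstDeriv)

variable {𝕜}

theorem exists_Ioo_subset {r : ℝ} (hr : 0 < r) (hl : ∀ e, (r : EReal) ≤ Γ.b e - Γ.a e)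
    (p : Γ.Endpoint) : ∃ c : ℝ, Ioo c (c + r) ⊆ Γ.edge (p.elim Subtype.val Subtype.val) ∧
      p.elim (fun e => (Γ.a e.1).toReal) (fun e => (Γ.b e.1).toReal) ∈ Icc c (c + r) := by
  rcases p with ⟨e, he⟩ | ⟨e, he⟩
  · have hab := Γ.a_lt_b e
    have hle := hl e
    obtain ⟨α, hα⟩ : ∃ α : ℝ, Γ.a e = α :=
      ⟨(Γ.a e).toReal, (EReal.coe_toReal (ne_top_of_lt hab) he.ne').symm⟩
    refine ⟨α, fun x hx => ⟨?_, ?_⟩, ?_⟩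
    · change Γ.a e < _
      rw [hα]; exact_mod_cast hx.1
    · change _ < Γ.b e
      rw [hα] at hle
      have h1 : ((α + r : ℝ) : EReal) ≤ Γ.b e := by
        have := (EReal.le_sub_iff_add_le (.inl (EReal.coe_ne_bot α))
          (.inl (EReal.coe_ne_top α))).1 hle
        rw [add_comm] at this
        exact_mod_cast this
      exact lt_of_lt_of_le (by exact_mod_cast hx.2) h1
    · simp only [Sum.elim_inl, hα, EReal.toReal_coe, mem_Icc]; constructor <;> linarith
  · have hab := Γ.a_lt_b e
    have hle := hl e
    obtain ⟨β, hβ⟩ : ∃ β : ℝ, Γ.b e = β :=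
      ⟨(Γ.b e).toReal, (EReal.coe_toReal he.ne (ne_bot_of_gt hab)).symm⟩
    refine ⟨β - r, fun x hx => ⟨?_, ?_⟩, ?_⟩
    · change Γ.a e < _
      rw [hβ] at hle hab
      have h1 : Γ.a e ≤ ((β - r : ℝ) : EReal) := by
        induction h : Γ.a e with
        | bot => exact bot_le
        | top => rw [h] at hab; exact absurd hab (not_lt.2 le_top)
        | coe α =>
          rw [h] at hle
          have : r ≤ β - α := by exact_mod_cast hle
          exact_mod_cast (by linarith : α ≤ β - r)
      exact lt_of_le_of_lt h1 (by exact_mod_cast hx.1)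
    · change _ < Γ.b e
      have := hx.2
      rw [hβ]; exact_mod_cast (by linarith : x < β)
    · simp only [Sum.elim_inr, hβ, EReal.toReal_coe, mem_Icc]; constructor <;> linarith

/-- The boundary values of `f`: `(e, 0) ↦ fₑ(aₑ)`, `(e, 1) ↦ fₑ(bₑ)`. -/
noncomputable def boundaryValues (f : Γ.Space 𝕜) : Γ.Endpoint → 𝕜
  | .inl e => boundaryValue (Γ.edge e) (f e) (Γ.a e).toReal
  | .inr e => boundaryValue (Γ.edge e) (f e) (Γ.b e).toReal

/-- The signed boundary values of `f`: `(e, 0) ↦ fₑ(aₑ)`, `(e, 1) ↦ -fₑ(bₑ)`. -/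
noncomputable def signedBoundaryValues (f : Γ.Space 𝕜) : Γ.Endpoint → 𝕜
  | .inl e => boundaryValue (Γ.edge e) (f e) (Γ.a e).toReal
  | .inr e => -boundaryValue (Γ.edge e) (f e) (Γ.b e).toReal

theorem norm_signedBoundaryValues (f : Γ.Space 𝕜) (p : Γ.Endpoint) :
    ‖Γ.signedBoundaryValues f p‖ = ‖Γ.boundaryValues f p‖ := by
  cases p <;> simp [signedBoundaryValues, boundaryValues]

theorem norm_boundaryValues_sq_le {r : ℝ} (hr : 0 < r) (hl : ∀ e, (r : EReal) ≤ Γ.b e - Γ.a e)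
    {f g : Γ.Space 𝕜} (hg : Γ.HasWeakDeriv f g) (p : Γ.Endpoint) :
    ‖Γ.boundaryValues f p‖ ^ 2
      ≤ 2 / r * ‖f (p.elim Subtype.val Subtype.val)‖ ^ 2 + 2 * r * ‖g (p.elim Subtype.val Subtype.val)‖ ^ 2 := by
  obtain ⟨c, hc, hp⟩ := Γ.exists_Ioo_subset hr hl p
  have := norm_boundaryValue_sq_le (Γ.isOpen_edge _) (Γ.ordConnected_edge _)
    (hg (p.elim Subtype.val Subtype.val)) (by linarith : c < c + r) hc hp
  rw [add_sub_cancel_left] at this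
  cases p <;> exact this

theorem exists_length {Γ : MetricGraph V E} (hΓ : 0 < ⨅ e, (Γ.b e - Γ.a e)) :
    ∃ r : ℝ, 0 < r ∧ ∀ e, (r : EReal) ≤ Γ.b e - Γ.a e := by
  obtain ⟨r, hr, hlt⟩ := EReal.lt_iff_exists_real_btwn.1 hΓ
  exact ⟨r, by exact_mod_cast hr, fun e => hlt.le.trans (iInf_le _ e)⟩

theorem memℓp_boundaryValues (hΓ : 0 < ⨅ e, (Γ.b e - Γ.a e)) (f : Γ.W1 𝕜) :
    Memℓp (Γ.boundaryValues (f : Γ.Space 𝕜)) 2 := by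
  obtain ⟨r, hr, hl⟩ := exists_length hΓ
  obtain ⟨f, g, hg⟩ := f
  have hs : ∀ u : Γ.Space 𝕜, Summable fun e => ‖u e‖ ^ 2 := fun u => by
    have := (lp.memℓp u).summable (by simp)
    simpa using this
  have hS : Summable fun e => 2 / r * ‖f e‖ ^ 2 + 2 * r * ‖g e‖ ^ 2 :=
    ((hs f).mul_left _).add ((hs g).mul_left _)
  refine memℓp_gen ?_
  simp only [ENNReal.toReal_ofNat, Real.rpow_ofNat]
  refine Summable.of_nonneg_of_le (fun p => by positivity)
    (fun p => Γ.norm_boundaryValues_sq_le hr hl hg p) ?_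
  exact Summable.sum _ (hS.subtype _) (hS.subtype _)

theorem memℓp_signedBoundaryValues (hΓ : 0 < ⨅ e, (Γ.b e - Γ.a e)) (f : Γ.W1 𝕜) :
    Memℓp (Γ.signedBoundaryValues (f : Γ.Space 𝕜)) 2 := by
  have h := (Γ.memℓp_boundaryValues hΓ f).summable (by simp)
  refine memℓp_gen ?_
  simp_rw [norm_signedBoundaryValues]
  exact h

theorem boundaryValues_add (hΓ : 0 < ⨅ e, (Γ.b e - Γ.a e)) (f g : Γ.W1 𝕜) (p : Γ.Endpoint) :
    Γ.boundaryValues (f + g : Γ.Space 𝕜) p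
      = Γ.boundaryValues (f : Γ.Space 𝕜) p + Γ.boundaryValues (g : Γ.Space 𝕜) p := by
  obtain ⟨r, hr, hl⟩ := exists_length hΓ
  obtain ⟨c, hc, hp⟩ := Γ.exists_Ioo_subset hr hl p
  obtain ⟨f, f', hf⟩ := f
  obtain ⟨g, g', hg⟩ := g
  have := boundaryValue_add (Γ.isOpen_edge _) (Γ.ordConnected_edge _)
    (hf (p.elim Subtype.val Subtype.val)) (hg (p.elim Subtype.val Subtype.val))
    (closure_mono hc (by rwa [closure_Ioo (by linarith)]))
  cases p <;> exact this

theorem boundaryValues_smul (hΓ : 0 < ⨅ e, (Γ.b e - Γ.a e)) (c : 𝕜) (f : Γ.W1 𝕜)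
    (p : Γ.Endpoint) :
    Γ.boundaryValues (c • f : Γ.Space 𝕜) p = c * Γ.boundaryValues (f : Γ.Space 𝕜) p := by
  obtain ⟨r, hr, hl⟩ := exists_length hΓ
  obtain ⟨d, hd, hp⟩ := Γ.exists_Ioo_subset hr hl p
  obtain ⟨f, f', hf⟩ := f
  have := boundaryValue_smul (Γ.isOpen_edge _) (Γ.ordConnected_edge _) c
    (hf (p.elim Subtype.val Subtype.val)) (closure_mono hd (by rwa [closure_Ioo (by linarith)]))
  cases p <;> exact this

/-- The trace `⨁ₑ W_2^1(aₑ, bₑ) → ℓ₂(E')`, defined if the edge lengths have a positive lower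
bound. -/
noncomputable def trace (hΓ : 0 < ⨅ e, (Γ.b e - Γ.a e)) :
    Γ.W1 𝕜 →ₗ[𝕜] Γ.BoundarySpace 𝕜 where
  toFun f := ⟨Γ.boundaryValues (f : Γ.Space 𝕜), Γ.memℓp_boundaryValues hΓ f⟩
  map_add' f g := lp.ext (funext fun p => Γ.boundaryValues_add hΓ f g p)
  map_smul' c f := lp.ext (funext fun p => Γ.boundaryValues_smul hΓ c f p)

/-- The signed trace `⨁ₑ W_2^1(aₑ, bₑ) → ℓ₂(E')`, defined if the edge lengths have a positive
lower bound. -/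
noncomputable def signedTrace (hΓ : 0 < ⨅ e, (Γ.b e - Γ.a e)) :
    Γ.W1 𝕜 →ₗ[𝕜] Γ.BoundarySpace 𝕜 where
  toFun f := ⟨Γ.signedBoundaryValues (f : Γ.Space 𝕜), Γ.memℓp_signedBoundaryValues hΓ f⟩
  map_add' f g := lp.ext (funext fun p => by
    have h := Γ.boundaryValues_add hΓ f g p
    rcases p with e | e
    · exact h
    · exact (congrArg Neg.neg h).trans (neg_add _ _))
  map_smul' c f := lp.ext (funext fun p => by
    have h := Γ.boundaryValues_smul hΓ c f p
    rcases p with e | e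
    · exact h
    · exact (congrArg Neg.neg h).trans (neg_mul_eq_mul_neg _ _))

end MetricGraph

end QuantumGraph

/-! The trace `tr f` and the signed trace `str f'` form a boundary triple for the maximal Laplacian,
and the theorem is the description of self-adjoint restrictions that every boundary triple provides.

Abstract half. Let `Γ₀`, `Γ₁` satisfy Green's identity for `A`, let `(Γ₀, Γ₁)` be surjective onto `B
× B`, and let `A` be the adjoint of its restriction to the joint kernel. Then a self-adjoint
restriction `H` is determined by the image `Θ` of its domain under `(Γ₀, Γ₁)`, and `Θ` is a
self-adjoint linear relation in `B`. Such a relation splits: with `X` the closure of its domain, its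
multivalued part is `Xᗮ`, and what remains inside `X × X` is the graph of a self-adjoint operator
`L`. Hence `(x, u) ∈ Θ` means `x ∈ D(L)` and `L x = Q u`. The converse is a direct computation of
the adjoint. Both directions use only Green's identity, surjectivity and maximality, so no
semiboundedness enters (`IsBoundaryTriple.exists_boundary_of_isSelfAdjoint`,
`IsBoundaryTriple.isSelfAdjoint_of_boundary`).

Concrete half. Green's identity is integration by parts, obtained from the fundamental theorem of
calculus for `|f|²` on each edge, summation over edges, and polarisation (`inner_weakDeriv_add`).
The lower bound on edge lengths permits bumps of one fixed size at all endpoints, hence bounded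
extension operators from `ℓ₂(E')` (`exists_boundary_extension`). The Neumann problem `f - f'' = h`,
`str f' = 0` is solved by orthogonal projection onto the graph of the weak derivative
(`exists_weak_solution`). These facts yield surjectivity and maximality through
`IsBoundaryTriple.of_neumann`. -/

namespace QuantumGraph

/-! ### Abstract boundary triples and self-adjoint restrictions -/

section BoundaryTriple

open LinearPMap
open scoped InnerProductSpace

variable {𝕜 ℋ B : Type*} [RCLike 𝕜]
  [NormedAddCommGroup ℋ] [InnerProductSpace 𝕜 ℋ] [NormedAddCommGroup B] [InnerProductSpace 𝕜 B]
  {A : ℋ →ₗ.[𝕜] ℋ} {Γ₀ Γ₁ : A.domain →ₗ[𝕜] B}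

/-- Green's identity for the boundary maps `Γ₀`, `Γ₁` of the operator `A`. -/
def GreenIdentity (A : ℋ →ₗ.[𝕜] ℋ) (Γ₀ Γ₁ : A.domain →ₗ[𝕜] B) : Prop :=
  ∀ f g : A.domain, ⟪A f, (g : ℋ)⟫_𝕜 - ⟪(f : ℋ), A g⟫_𝕜 = ⟪Γ₁ f, Γ₀ g⟫_𝕜 - ⟪Γ₀ f, Γ₁ g⟫_𝕜

/-- `(B, Γ₀, Γ₁)` is a boundary triple for `A`, where `A` is the adjoint of its restriction to
the joint kernel of `Γ₀` and `Γ₁`. -/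
structure IsBoundaryTriple (A : ℋ →ₗ.[𝕜] ℋ) (Γ₀ Γ₁ : A.domain →ₗ[𝕜] B) : Prop where
  green : GreenIdentity A Γ₀ Γ₁
  surjective : ∀ x u : B, ∃ f, Γ₀ f = x ∧ Γ₁ f = u
  maximal : ∀ y w : ℋ, (∀ g : A.domain, Γ₀ g = 0 → Γ₁ g = 0 → ⟪w, (g : ℋ)⟫_𝕜 = ⟪y, A g⟫_𝕜) →
    ∃ hy : y ∈ A.domain, A ⟨y, hy⟩ = w

/-- Green's identity, a bounded extension operator and the solvability of `(1 + A) f = h` with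
Neumann boundary condition give a boundary triple. -/
theorem IsBoundaryTriple.of_neumann [CompleteSpace B] (green : GreenIdentity A Γ₀ Γ₁)
    (surj : ∀ u : B, ∃ f, Γ₁ f = u)
    (neumann : ∀ h : ℋ, ∃ f : A.domain, Γ₁ f = 0 ∧ (f : ℋ) + A f = h) {C : ℝ}
    (ext : ∀ x : B, ∃ f : A.domain, Γ₀ f = x ∧ Γ₁ f = 0 ∧ ‖(f : ℋ) + A f‖ ≤ C * ‖x‖) :
    IsBoundaryTriple A Γ₀ Γ₁ where
  green := green
  surjective x u := by
    obtain ⟨f, hf⟩ := surj u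
    obtain ⟨g, hg0, hg1, -⟩ := ext (x - Γ₀ f)
    exact ⟨f + g, by simp [hg0], by simp [hg1, hf]⟩
  maximal y w hyw := by
    obtain ⟨f, hf1, hf⟩ := neumann (y + w)
    -- If `y ∈ D(A)` and `A y = w`, then `z` must solve `(1 + A) z = 0`. The rest of the proof
    -- constructs such a solution `h` and shows `z = h`.
    obtain ⟨z, hz⟩ : ∃ z, z = y - f := ⟨_, rfl⟩
    have hzg : ∀ g : A.domain, Γ₀ g = 0 → Γ₁ g = 0 → ⟪z, (g : ℋ) + A g⟫_𝕜 = 0 := fun g h0 h1 => by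
      have e1 := green f g
      have e2 : ⟪(f : ℋ) + A f, (g : ℋ)⟫_𝕜 = ⟪y + w, (g : ℋ)⟫_𝕜 := by rw [hf]
      rw [h0, h1, inner_zero_right, inner_zero_right] at e1
      rw [inner_add_left, inner_add_left] at e2
      rw [hz, inner_sub_left, inner_add_right, inner_add_right, ← hyw g h0 h1]
      linear_combination e1 - e2
    choose e he0 he1 heC using ext
    -- On Neumann functions `g`, the pairing of `z` with `(1 + A) g` depends only on `Γ₀ g`. It is
    -- therefore a linear functional on `B`, bounded by the extension estimate, and Riesz represents
    -- it by `χ`.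
    have key : ∀ g x, Γ₁ g = 0 → Γ₀ g = x →
        ⟪z, (g : ℋ) + A g⟫_𝕜 = ⟪z, (e x : ℋ) + A (e x)⟫_𝕜 := fun g x h1 h0 => by
      have := hzg (g - e x) (by rw [_root_.map_sub, h0, he0, sub_self]) (by rw [_root_.map_sub, h1, he1, sub_self])
      rw [LinearPMap.map_sub, Submodule.coe_sub, sub_add_sub_comm, inner_sub_right] at this
      exact sub_eq_zero.1 this
    let l : B →ₗ[𝕜] 𝕜 :=
      { toFun := fun x => ⟪z, (e x : ℋ) + A (e x)⟫_𝕜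
        map_add' := fun x x' => by
          rw [← key (e x + e x') (x + x') (by simp [he1]) (by simp [he0]), LinearPMap.map_add,
            Submodule.coe_add, add_add_add_comm, inner_add_right]
        map_smul' := fun c x => by
          rw [← key (c • e x) (c • x) (by simp [he1]) (by simp [he0]), LinearPMap.map_smul,
            Submodule.coe_smul, ← smul_add, inner_smul_right]
          rfl }
    let L : StrongDual 𝕜 B := l.mkContinuous (‖z‖ * C) fun x => by
      refine (norm_inner_le_norm _ _).trans ?_
      rw [mul_assoc]
      exact mul_le_mul_of_nonneg_left (heC x) (norm_nonneg _)
    obtain ⟨χ, hχ⟩ : ∃ χ : B, ∀ x, ⟪χ, x⟫_𝕜 = ⟪z, (e x : ℋ) + A (e x)⟫_𝕜 :=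
      ⟨(InnerProductSpace.toDual 𝕜 B).symm L, fun x => InnerProductSpace.toDual_symm_apply⟩
    -- Green's identity forces the boundary datum `Γ₁ h = -χ` if `h` is to induce the same
    -- functional as `z`. Subtracting the Neumann solution `n` achieves `(1 + A) h = 0` without
    -- changing `Γ₁`.
    obtain ⟨h₀, hh₀⟩ := surj (-χ)
    obtain ⟨n, hn1, hn⟩ := neumann (h₀ + A h₀)
    obtain ⟨h, hh⟩ : ∃ h, h = h₀ - n := ⟨_, rfl⟩
    have hh1 : Γ₁ h = -χ := by rw [hh, _root_.map_sub, hn1, hh₀, sub_zero]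
    have hA : (h : ℋ) + A h = 0 := by
      rw [hh, LinearPMap.map_sub, Submodule.coe_sub, sub_add_sub_comm, hn, sub_self]
    have hzh : z = h := by
      -- With this `g`, both `z` and `h` pair with `(1 + A) g = z - h` to the same value, so `z - h`
      -- is orthogonal to itself.
      obtain ⟨g, hg1, hg⟩ := neumann (z - h)
      have e1 := green h g
      have e2 : ⟪(h : ℋ) + A h, (g : ℋ)⟫_𝕜 = 0 := by rw [hA, inner_zero_left]
      rw [hh1, hg1, inner_zero_right, inner_neg_left, hχ, ← key g _ hg1 rfl] at e1
      rw [inner_add_left] at e2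
      have : ⟪z - h, z - h⟫_𝕜 = 0 := by
        nth_rw 2 [← hg]
        rw [inner_sub_left, inner_add_right (h : ℋ)]
        linear_combination e1 - e2
      exact sub_eq_zero.1 (inner_self_eq_zero.1 this)
    have hy : y = (f + h : A.domain) := by
      rw [Submodule.coe_add, ← hzh, hz]; abel
    have hyA : A (f + h) = w := by
      rw [LinearPMap.map_add, eq_neg_of_add_eq_zero_right hA, ← hzh, hz, ← sub_eq_add_neg,
        sub_sub_eq_add_sub, add_comm, hf]
      abel
    subst hy
    exact ⟨(f + h).2, hyA⟩

variable [CompleteSpace ℋ]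

/-- A vector `w` orthogonal to the joint kernel satisfies the maximality condition for the pair `(0,
w)`, so `w = A 0 = 0`. -/
theorem IsBoundaryTriple.dense (hT : IsBoundaryTriple A Γ₀ Γ₁) {S : Submodule 𝕜 ℋ}
    (hS : ∀ g : A.domain, Γ₀ g = 0 → Γ₁ g = 0 → (g : ℋ) ∈ S) : Dense (S : Set ℋ) := by
  rw [Submodule.dense_iff_topologicalClosure_eq_top, Submodule.topologicalClosure_eq_top_iff,
    Submodule.eq_bot_iff]
  intro w hw
  obtain ⟨h0, h1⟩ := hT.maximal 0 w fun g hg0 hg1 => by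
    rw [inner_zero_left]; exact (S.mem_orthogonal' w).1 hw _ (hS g hg0 hg1)
  rw [← h1, show (⟨0, h0⟩ : A.domain) = 0 from rfl, LinearPMap.map_zero]

/-- The restriction of `A` given by the abstract boundary condition
`Γ₀ f ∈ D(L)`, `L (Γ₀ f) = Q (Γ₁ f)` is self-adjoint. -/
theorem IsBoundaryTriple.isSelfAdjoint_of_boundary (hT : IsBoundaryTriple A Γ₀ Γ₁)
    {H : ℋ →ₗ.[𝕜] ℋ} (hH : H ≤ A) (X : Submodule 𝕜 B) [CompleteSpace X]
    (L : X →ₗ.[𝕜] X) (hL : IsSelfAdjoint L)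
    (hdom : ∀ f : A.domain, (f : ℋ) ∈ H.domain ↔ ∃ x : L.domain, ((x : X) : B) = Γ₀ f ∧
      L x = X.orthogonalProjectionOnto (Γ₁ f)) :
    IsSelfAdjoint H := by
  have hHA : ∀ (f : H.domain), H f = A ⟨f, hH.1 f.2⟩ := fun f => hH.2 rfl
  have hdense : Dense (H.domain : Set ℋ) := hT.dense fun g h0 h1 =>
    (hdom g).2 ⟨0, by simp [h0], by simp [h1, LinearPMap.map_zero]⟩
  have hLd := hL.dense_domain
  have hLs : ∀ x y : L.domain, ⟪L x, (y : X)⟫_𝕜 = ⟪(x : X), L y⟫_𝕜 := by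
    have h := LinearPMap.adjoint_isFormalAdjoint hLd
    rw [isSelfAdjoint_def.1 hL] at h
    exact h
  have proj : ∀ (u : B) (x : X), ⟪u, (x : B)⟫_𝕜 = ⟪X.orthogonalProjectionOnto u, x⟫_𝕜 :=
    fun u x => by simp
  have proj' : ∀ (u : B) (x : X), ⟪(x : B), u⟫_𝕜 = ⟪x, X.orthogonalProjectionOnto u⟫_𝕜 :=
    fun u x => by simp
  have hsymm : H.IsFormalAdjoint H := fun f g => by
    obtain ⟨x, hx, hx'⟩ := (hdom ⟨f, hH.1 f.2⟩).1 f.2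
    obtain ⟨y, hy, hy'⟩ := (hdom ⟨g, hH.1 g.2⟩).1 g.2
    have := hT.green ⟨f, hH.1 f.2⟩ ⟨g, hH.1 g.2⟩
    rw [← hx, ← hy, proj, proj', ← hx', ← hy', hLs, sub_self, ← hHA, ← hHA] at this
    exact sub_eq_zero.1 this
  have hle := hsymm.le_adjoint hdense
  refine isSelfAdjoint_def.2 (LinearPMap.eq_of_le_of_domain_eq hle (le_antisymm hle.1 ?_)).symm
  intro y hy
  have hadj := LinearPMap.adjoint_isFormalAdjoint hdense ⟨y, hy⟩
  obtain ⟨hyA, hyw⟩ := hT.maximal y (H.adjoint ⟨y, hy⟩) fun g h0 h1 => by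
    have hg : (g : ℋ) ∈ H.domain :=
      (hdom g).2 ⟨0, by simp [h0], by simp [h1, LinearPMap.map_zero]⟩
    exact (hadj ⟨g, hg⟩).trans (by rw [hHA])
  have hb : ∀ f : A.domain, (f : ℋ) ∈ H.domain →
      ⟪Γ₁ ⟨y, hyA⟩, Γ₀ f⟫_𝕜 = ⟪Γ₀ ⟨y, hyA⟩, Γ₁ f⟫_𝕜 := fun f hf => by
    have h1 := hT.green ⟨y, hyA⟩ f
    have h2 := hadj ⟨f, hf⟩
    rw [hHA] at h2
    rw [hyw, h2, sub_self] at h1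
    exact sub_eq_zero.1 h1.symm
  -- Functions with `Γ₀ f = 0` and `Γ₁ f ∈ Xᗮ` satisfy the boundary condition with `x = 0`. Testing
  -- against them puts `Γ₀ y` in the double complement of `X`.
  have hX : Γ₀ ⟨y, hyA⟩ ∈ X := by
    rw [← X.orthogonal_orthogonal, Submodule.mem_orthogonal']
    intro u hu
    obtain ⟨f, hf0, hf1⟩ := hT.surjective 0 u
    have := hb f ((hdom f).2 ⟨0, by simp [hf0], by
      rw [LinearPMap.map_zero, hf1]
      exact (Submodule.orthogonalProjectionOnto_eq_zero_iff.2 hu).symm⟩)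
    rw [hf0, hf1, inner_zero_right] at this
    exact this.symm
  -- Testing against `f` with boundary data `(x, L x)` shows that `Γ₀ y` lies in the domain of the
  -- adjoint of `L`, which is `L` itself.
  have hform : ∀ x : L.domain, ⟪X.orthogonalProjectionOnto (Γ₁ ⟨y, hyA⟩), (x : X)⟫_𝕜
      = ⟪(⟨Γ₀ ⟨y, hyA⟩, hX⟩ : X), L x⟫_𝕜 := fun x => by
    obtain ⟨f, hf0, hf1⟩ := hT.surjective x (L x)
    have := hb f ((hdom f).2 ⟨x, hf0.symm, by
      rw [hf1, Submodule.orthogonalProjectionOnto_mem_subspace_eq_self]⟩)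
    rw [hf0, hf1, proj] at this
    exact this
  have hmem := LinearPMap.mem_adjoint_domain_of_exists (⟨Γ₀ ⟨y, hyA⟩, hX⟩ : X) ⟨_, hform⟩
  have hval := LinearPMap.adjoint_apply_eq hLd ⟨_, hmem⟩ hform
  have hLadj := isSelfAdjoint_def.1 hL
  have hmem' : (⟨Γ₀ ⟨y, hyA⟩, hX⟩ : X) ∈ L.domain := hLadj ▸ hmem
  refine (hdom ⟨y, hyA⟩).2 ⟨⟨_, hmem'⟩, rfl, ?_⟩
  rw [← hval]
  exact hLadj.symm.le.2 rfl

/-- Every self-adjoint restriction of `A` is given by an abstract boundary condition. -/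
theorem IsBoundaryTriple.exists_boundary_of_isSelfAdjoint [CompleteSpace B]
    (hT : IsBoundaryTriple A Γ₀ Γ₁) {H : ℋ →ₗ.[𝕜] ℋ} (hH : H ≤ A) (hsa : IsSelfAdjoint H) :
    ∃ (X : Submodule 𝕜 B) (_ : IsClosed (X : Set B)) (_ : CompleteSpace X) (L : X →ₗ.[𝕜] X),
      IsSelfAdjoint L ∧ ∀ f : A.domain, (f : ℋ) ∈ H.domain ↔
        ∃ x : L.domain, ((x : X) : B) = Γ₀ f ∧ L x = X.orthogonalProjectionOnto (Γ₁ f) := by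
  have hHA : ∀ (f : H.domain), H f = A ⟨f, hH.1 f.2⟩ := fun f => hH.2 rfl
  have hd := hsa.dense_domain
  have hadj := isSelfAdjoint_def.1 hsa
  have hsymm : ∀ f g : A.domain, (f : ℋ) ∈ H.domain → (g : ℋ) ∈ H.domain →
      ⟪A f, (g : ℋ)⟫_𝕜 = ⟪(f : ℋ), A g⟫_𝕜 := fun f g hf hg => by
    have h := LinearPMap.adjoint_isFormalAdjoint hd
    rw [hadj] at h
    have := h ⟨f, hf⟩ ⟨g, hg⟩
    rwa [hHA, hHA] at this
  -- Membership in `D(H)` can be tested on boundary data alone: vanishing boundary terms mean `f ∈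
  -- D(H*) = D(H)`.
  have hmax : ∀ f : A.domain, (∀ g : A.domain, (g : ℋ) ∈ H.domain →
      ⟪Γ₁ f, Γ₀ g⟫_𝕜 = ⟪Γ₀ f, Γ₁ g⟫_𝕜) → (f : ℋ) ∈ H.domain := fun f hf => by
    rw [← hadj]
    refine LinearPMap.mem_adjoint_domain_of_exists _ ⟨A f, fun g => ?_⟩
    have := hT.green f ⟨g, hH.1 g.2⟩
    rw [hf _ g.2, sub_self, ← hHA] at this
    exact sub_eq_zero.1 this
  have hsymm' : ∀ f g : A.domain, (f : ℋ) ∈ H.domain → (g : ℋ) ∈ H.domain →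
      ⟪Γ₁ f, Γ₀ g⟫_𝕜 = ⟪Γ₀ f, Γ₁ g⟫_𝕜 := fun f g hf hg => by
    have := hT.green f g
    rw [hsymm f g hf hg, sub_self] at this
    exact (sub_eq_zero.1 this.symm)
  let Θ : Submodule 𝕜 (B × B) := (H.domain.comap A.domain.subtype).map (Γ₀.prod Γ₁)
  have memΘ : ∀ f : A.domain, (f : ℋ) ∈ H.domain ↔ (Γ₀ f, Γ₁ f) ∈ Θ := fun f => by
    refine ⟨fun hf => ⟨f, hf, rfl⟩, ?_⟩
    rintro ⟨g, hg, hgf⟩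
    have hg0 : Γ₀ g = Γ₀ f := congrArg Prod.fst hgf
    have hg1 : Γ₁ g = Γ₁ f := congrArg Prod.snd hgf
    refine hmax f fun k hk => ?_
    rw [← hg0, ← hg1]
    exact hsymm' g k hg hk
  have symmΘ : ∀ p q, p ∈ Θ → q ∈ Θ → ⟪p.2, q.1⟫_𝕜 = ⟪p.1, q.2⟫_𝕜 := by
    rintro _ _ ⟨f, hf, rfl⟩ ⟨g, hg, rfl⟩
    exact hsymm' f g hf hg
  -- Together with `symmΘ` this makes `Θ` a self-adjoint linear relation; surjectivity of `(Γ₀, Γ₁)`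
  -- is what lifts `(x, u)` to some `f`.
  have maxΘ : ∀ x u : B, (∀ q ∈ Θ, ⟪u, q.1⟫_𝕜 = ⟪x, q.2⟫_𝕜) → (x, u) ∈ Θ := fun x u h => by
    obtain ⟨f, rfl, rfl⟩ := hT.surjective x u
    exact (memΘ f).1 (hmax f fun g hg => h _ ((memΘ g).1 hg))
  let X : Submodule 𝕜 B := (Θ.map (LinearMap.fst 𝕜 B B)).topologicalClosure
  have hXc : IsClosed (X : Set B) := Submodule.isClosed_topologicalClosure _
  have : CompleteSpace X := hXc.completeSpace_coe
  -- The multivalued part of a self-adjoint relation is the orthogonal complement of its domain.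
  -- Second components may thus be projected to `X` (`projΘ`), and within `X` the relation is
  -- single-valued (`hG`).
  have mulΘ : ∀ u, (0, u) ∈ Θ ↔ u ∈ Xᗮ := fun u => by
    rw [Submodule.orthogonal_closure, Submodule.mem_orthogonal']
    constructor
    · rintro hu _ ⟨q, hq, rfl⟩
      simpa using symmΘ (0, u) q hu hq
    · intro h
      refine maxΘ 0 u fun q hq => ?_
      rw [inner_zero_left]
      exact h q.1 ⟨q, hq, rfl⟩
  have fstX : ∀ {x u : B}, (x, u) ∈ Θ → x ∈ X := fun {x u} h =>
    Submodule.le_topologicalClosure _ ⟨(x, u), h, rfl⟩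
  have projΘ : ∀ (x : X) (u : B),
      ((x : B), u) ∈ Θ ↔ ((x : B), (X.orthogonalProjectionOnto u : B)) ∈ Θ := fun x u => by
    have h : ((x : B), u) - ((x : B), (X.orthogonalProjectionOnto u : B)) ∈ Θ := by
      rw [Prod.mk_sub_mk, sub_self, mulΘ]
      exact X.sub_starProjection_mem_orthogonal u
    exact ⟨fun h' => by simpa using Θ.sub_mem h' h, fun h' => by simpa using Θ.add_mem h h'⟩
  let G : Submodule 𝕜 (X × X) := Θ.comap (X.subtype.prodMap X.subtype)
  have memG : ∀ p : X × X, p ∈ G ↔ ((p.1 : B), (p.2 : B)) ∈ Θ := fun p => Iff.rfl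
  have hG : ∀ p ∈ G, p.1 = 0 → p.2 = 0 := fun p hp h0 => by
    rw [memG, h0, Submodule.coe_zero, mulΘ] at hp
    exact Subtype.ext (inner_self_eq_zero (𝕜 := 𝕜).1 (hp _ p.2.2))
  let L : X →ₗ.[𝕜] X := G.toLinearPMap
  have hgraph : L.graph = G := Submodule.toLinearPMap_graph_eq G hG
  have memL : ∀ x v : X, ((x : B), (v : B)) ∈ Θ ↔ ∃ hx : x ∈ L.domain, L ⟨x, hx⟩ = v := by
    intro x v
    rw [← memG (x, v), ← hgraph, LinearPMap.mem_graph_iff]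
    constructor
    · rintro ⟨y, rfl, hy⟩; exact ⟨y.2, hy⟩
    · rintro ⟨hx, h⟩; exact ⟨⟨x, hx⟩, rfl, h⟩
  refine ⟨X, hXc, inferInstance, L, ?_, fun f => ?_⟩
  · have hLΘ : ∀ x : L.domain, (((x : X) : B), (L x : B)) ∈ Θ := fun x => (memL _ _).2 ⟨x.2, rfl⟩
    have hLd : Dense (L.domain : Set X) := by
      rw [Submodule.dense_iff_topologicalClosure_eq_top, Submodule.topologicalClosure_eq_top_iff,
        Submodule.eq_bot_iff]
      intro v hv
      have : (v : B) ∈ Xᗮ := by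
        rw [Submodule.orthogonal_closure, Submodule.mem_orthogonal']
        rintro _ ⟨⟨x, u⟩, hq, rfl⟩
        have h1 := (projΘ ⟨x, fstX hq⟩ u).1 hq
        obtain ⟨hx, -⟩ := (memL ⟨x, fstX hq⟩ _).1 h1
        exact (Submodule.mem_orthogonal' _ _).1 hv _ hx
      exact Subtype.ext (inner_self_eq_zero (𝕜 := 𝕜).1 (this _ v.2))
    have hLs : L.IsFormalAdjoint L := fun x y => symmΘ _ _ (hLΘ x) (hLΘ y)
    have hle := hLs.le_adjoint hLd
    refine isSelfAdjoint_def.2 (LinearPMap.eq_of_le_of_domain_eq hle (le_antisymm hle.1 ?_)).symm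
    intro x hx
    have hadjL := LinearPMap.adjoint_isFormalAdjoint hLd ⟨x, hx⟩
    have : ((x : B), (L.adjoint ⟨x, hx⟩ : B)) ∈ Θ := maxΘ _ _ fun q hq => by
      obtain ⟨k, u⟩ := q
      obtain ⟨hk, hk'⟩ := (memL ⟨k, fstX hq⟩ _).1 ((projΘ ⟨k, fstX hq⟩ u).1 hq)
      have h1 := hadjL ⟨_, hk⟩
      rw [hk'] at h1
      exact h1.trans (by simp)
    exact ((memL _ _).1 this).1
  · rw [memΘ]
    constructor
    · intro h
      obtain ⟨hx, hx'⟩ := (memL ⟨Γ₀ f, fstX h⟩ _).1 ((projΘ ⟨Γ₀ f, fstX h⟩ _).1 h)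
      exact ⟨⟨_, hx⟩, rfl, hx'⟩
    · rintro ⟨x, hx, hL⟩
      rw [← hx, projΘ x, ← hL]
      exact (memL _ _).2 ⟨x.2, rfl⟩

end BoundaryTriple

open MeasureTheory Set Filter Topology
open scoped ENNReal ContDiff InnerProductSpace

/-! ### The fundamental theorem of calculus on possibly unbounded intervals -/

section HalfLine

variable {P p : ℝ → ℝ}

/-- If `b = ⊤`, integrability of `p` gives `P` a limit at infinity, and integrability of `P` forces
this limit to be `0`. An infinite end therefore has no boundary term. -/
theorem integral_Ioi_eq_boundary {b : EReal} {c : ℝ} (hc : (c : EReal) < b)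
    (hP : ∀ x y, P y - P x = ∫ t in x..y, p t) (hp : Integrable p)
    (h0 : ∀ x : ℝ, b ≤ x → p x = 0) (hPi : IntegrableOn P {x : ℝ | c < x ∧ (x : EReal) < b}) :
    ∫ x in Ioi c, p x = (if b < ⊤ then P b.toReal else 0) - P c := by
  by_cases hb : b < ⊤
  · rw [if_pos hb, hP]
    lift b to ℝ using ⟨hb.ne, (bot_lt_of_lt hc).ne'⟩
    rw [EReal.toReal_coe, intervalIntegral.integral_of_le (by exact_mod_cast hc.le)]
    refine setIntegral_eq_of_subset_of_forall_sdiff_eq_zero measurableSet_Ioi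
      Ioc_subset_Ioi_self fun x hx => h0 x ?_
    have : ¬ x ≤ b := fun h => hx.2 ⟨hx.1, h⟩
    exact_mod_cast (not_le.1 this).le
  · obtain rfl : b = ⊤ := not_lt_top_iff.1 hb
    rw [if_neg hb, zero_sub]
    have h1 := intervalIntegral_tendsto_integral_Ioi c hp.integrableOn tendsto_id
    have h2 : Tendsto P atTop (𝓝 ((∫ x in Ioi c, p x) + P c)) := by
      refine (h1.add_const (P c)).congr fun x => ?_
      rw [id, ← hP, sub_add_cancel]
    have h3 : IntegrableAtFilter P atTop := by
      refine ⟨Ioi c, Ioi_mem_atTop _, ?_⟩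
      exact hPi.mono_set fun x hx => ⟨hx, EReal.coe_lt_top x⟩
    have h4 := IntegrableAtFilter.eq_zero_of_tendsto h3 (fun s hs => by
      rcases mem_atTop_sets.1 hs with ⟨b, hb⟩
      rw [← top_le_iff, ← Real.volume_Ici (a := b)]
      exact measure_mono hb) h2
    linarith

/-- The reflection `x ↦ -x` reduces this to the right half-line. -/
theorem integral_Iic_eq_boundary {a : EReal} {c : ℝ} (hc : a < (c : EReal))
    (hP : ∀ x y, P y - P x = ∫ t in x..y, p t) (hp : Integrable p)
    (h0 : ∀ x : ℝ, x ≤ a → p x = 0) (hPi : IntegrableOn P {x : ℝ | x < c ∧ a < (x : EReal)}) :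
    ∫ x in Iic c, p x = P c - (if ⊥ < a then P a.toReal else 0) := by
  have h := integral_Ioi_eq_boundary (P := fun x => P (-x)) (p := fun x => -p (-x)) (b := -a)
    (c := -c) (by rw [EReal.coe_neg]; exact EReal.neg_lt_neg_iff.2 hc)
    (fun x y => by
      rw [intervalIntegral.integral_neg, intervalIntegral.integral_comp_neg, ← hP]; ring)
    hp.comp_neg.neg
    (fun x hx => by
      rw [h0 (-x) (by rw [EReal.coe_neg]; exact EReal.neg_le.1 hx), neg_zero])
    (by
      rw [← (Measure.measurePreserving_neg (volume : Measure ℝ)).integrableOn_comp_preimage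
        (MeasurableEquiv.neg ℝ).measurableEmbedding] at hPi
      refine hPi.congr_set_ae (Eventually.of_forall fun x => ?_)
      simp only [Set.preimage, mem_ofPred_eq, eq_iff_iff]
      change (-c < x ∧ (x : EReal) < -a) ↔ (-x < c ∧ a < ((-x : ℝ) : EReal))
      rw [EReal.coe_neg, neg_lt, EReal.lt_neg_comm])
  rw [integral_neg, integral_comp_neg_Ioi, neg_neg, EReal.toReal_neg_eq, neg_neg] at h
  rw [← neg_neg (∫ x in Iic c, p x), h]
  have : (-a < ⊤) ↔ ⊥ < a := by rw [← EReal.neg_bot, EReal.neg_lt_neg_iff]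
  simp_rw [this]
  ring

theorem integral_eq_boundary {a b : EReal} (hab : a < b)
    (hP : ∀ x y, P y - P x = ∫ t in x..y, p t) (hp : Integrable p)
    (ha : ∀ x : ℝ, x ≤ a → p x = 0) (hb : ∀ x : ℝ, b ≤ x → p x = 0)
    (hPi : IntegrableOn P {x : ℝ | a < (x : EReal) ∧ (x : EReal) < b}) :
    ∫ x, p x = (if b < ⊤ then P b.toReal else 0) - (if ⊥ < a then P a.toReal else 0) := by
  obtain ⟨c, hac, hcb⟩ := EReal.lt_iff_exists_real_btwn.1 hab
  rw [← intervalIntegral.integral_Iic_add_Ioi (b := c) hp.integrableOn hp.integrableOn,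
    integral_Iic_eq_boundary hac hP hp ha
      (hPi.mono_set fun x hx => ⟨hx.2, (EReal.coe_lt_coe_iff.2 hx.1).trans hcb⟩),
    integral_Ioi_eq_boundary hcb hP hp hb
      (hPi.mono_set fun x hx => ⟨hac.trans (EReal.coe_lt_coe_iff.2 hx.1), hx.2⟩)]
  ring

/-- The fundamental theorem of calculus for the square of an absolutely continuous function. -/
theorem sq_sub_sq_eq_integral {u v : ℝ → ℝ} (hv : LocallyIntegrable v)
    (huv : ∀ x y, u y - u x = ∫ t in x..y, v t) (x y : ℝ) :
    u y ^ 2 - u x ^ 2 = ∫ t in x..y, 2 * (u t * v t) := by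
  have hvi : ∀ a b : ℝ, IntervalIntegrable v volume a b := fun a b =>
    (hv.integrableOn_isCompact isCompact_uIcc).intervalIntegrable
  have hu : u = fun t => (∫ s in x..t, v s) + u x := by
    ext t; rw [← huv, sub_add_cancel]
  have ac : AbsolutelyContinuousOnInterval u x y := by
    have h1 := (hvi x y).absolutelyContinuousOnInterval_intervalIntegral (c := x) left_mem_uIcc
    have h2 : AbsolutelyContinuousOnInterval (fun _ : ℝ => u x) x y :=
      (contDiff_const (n := 1)).contDiffOn.absolutelyContinuousOnInterval
    rw [hu]
    exact h1.add h2
  have key := ac.integral_deriv_mul_eq_sub ac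
  rw [sq, sq, ← key]
  apply intervalIntegral.integral_congr_ae
  filter_upwards [(hvi x y).ae_hasDerivAt_integral] with t ht ht'
  have hd : HasDerivAt u (v t) t := by
    rw [hu]
    exact (ht (uIoc_subset_uIcc ht') x left_mem_uIcc).add_const _
  rw [hd.deriv]
  ring

end HalfLine

/-! ### Integration by parts on one edge, in quadratic form -/

section Edge

variable {𝕜 : Type*} [RCLike 𝕜] {I : Set ℝ}

/-- The real-valued identity is applied to the real and imaginary parts and added. -/
theorem norm_sq_sub_norm_sq_eq_integral {F g : ℝ → 𝕜} (hg : LocallyIntegrable g)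
    (hF : Continuous F) (hFg : ∀ x y, F y - F x = ∫ t in x..y, g t) (x y : ℝ) :
    ‖F y‖ ^ 2 - ‖F x‖ ^ 2 = ∫ t in x..y, 2 * RCLike.re ⟪F t, g t⟫_𝕜 := by
  have hgi : ∀ a b : ℝ, IntervalIntegrable g volume a b := fun a b =>
    (hg.integrableOn_isCompact isCompact_uIcc).intervalIntegrable
  have hA : ∀ A : 𝕜 →L[ℝ] ℝ, LocallyIntegrable (fun x => A (g x)) volume := fun A x => by
    obtain ⟨s, hs, hi⟩ := hg x
    exact ⟨s, hs, A.integrable_comp hi⟩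
  have hs : ∀ A : 𝕜 →L[ℝ] ℝ, A (F y) ^ 2 - A (F x) ^ 2
      = ∫ t in x..y, 2 * (A (F t) * A (g t)) := fun A =>
    sq_sub_sq_eq_integral (u := fun t => A (F t)) (hA A) (fun x y => by
      rw [← map_sub, hFg, A.intervalIntegral_comp_comm (hgi x y)]) x y
  have hi : ∀ A : 𝕜 →L[ℝ] ℝ, IntervalIntegrable (fun t => 2 * (A (F t) * A (g t))) volume x y :=
    fun A => ((((hA A).integrableOn_isCompact isCompact_uIcc).intervalIntegrable).continuousOn_mul
      (A.continuous.comp hF).continuousOn).const_mul 2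
  have h1 := hs RCLike.reCLM
  have h2 := hs RCLike.imCLM
  have e : ∀ z : 𝕜, ‖z‖ ^ 2 = RCLike.reCLM z ^ 2 + RCLike.imCLM z ^ 2 := fun z => by
    rw [RCLike.norm_sq_eq_def, RCLike.reCLM_apply, RCLike.imCLM_apply]; ring
  rw [e, e, add_sub_add_comm, h1, h2, ← intervalIntegral.integral_add (hi _) (hi _)]
  congr 1
  ext t
  simp [RCLike.inner_apply]
  ring

theorem two_mul_re_inner_eq_boundary {a b : EReal} (hab : a < b)
    (hI : I = {x : ℝ | a < (x : EReal) ∧ (x : EReal) < b})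
    {f g : Lp 𝕜 2 (volume.restrict I)} (h : IsWeakDeriv I f g)
    (ha : ⊥ < a → a.toReal ∈ closure I) (hb : b < ⊤ → b.toReal ∈ closure I) :
    2 * RCLike.re ⟪f, g⟫_𝕜 = (if b < ⊤ then ‖boundaryValue I f b.toReal‖ ^ 2 else 0)
      - (if ⊥ < a then ‖boundaryValue I f a.toReal‖ ^ 2 else 0) := by
  have hIo : IsOpen I := hI ▸ (isOpen_lt continuous_const continuous_coe_real_ereal).inter
    (isOpen_lt continuous_coe_real_ereal continuous_const)
  have hIc : I.OrdConnected := hI ▸ ⟨fun _ hx _ hy _ hz =>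
    ⟨hx.1.trans_le (EReal.coe_le_coe_iff.2 hz.1), (EReal.coe_le_coe_iff.2 hz.2).trans_lt hy.2⟩⟩
  obtain ⟨F, hF, hFf, hFg⟩ := h.exists_continuous hIo hIc
  have hgl := locInt g hIo.measurableSet
  let p : ℝ → ℝ := fun t => 2 * RCLike.re ⟪F t, I.indicator g t⟫_𝕜
  have hpI : p = I.indicator fun t => 2 * RCLike.re ⟪F t, g t⟫_𝕜 := by
    ext t; by_cases ht : t ∈ I <;> simp [p, ht]
  have hFg' : (fun t => 2 * RCLike.re ⟪F t, g t⟫_𝕜) =ᵐ[volume.restrict I]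
      fun t => 2 * RCLike.re ⟪f t, g t⟫_𝕜 := by
    filter_upwards [hFf] with t ht
    rw [ht]
  have hint : Integrable (fun t => 2 * RCLike.re ⟪f t, g t⟫_𝕜) (volume.restrict I) :=
    (L2.integrable_inner (𝕜 := 𝕜) f g).re.const_mul 2
  have hp : Integrable p := by
    rw [hpI, integrable_indicator_iff hIo.measurableSet]
    exact hint.congr hFg'.symm
  have hlhs : ∫ t, p t = 2 * RCLike.re ⟪f, g⟫_𝕜 := by
    rw [hpI, integral_indicator hIo.measurableSet, integral_congr_ae hFg', integral_const_mul,
      L2.inner_def, ← integral_re (L2.integrable_inner (𝕜 := 𝕜) f g)]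
  have hP := integral_eq_boundary (P := fun t => ‖F t‖ ^ 2) hab
    (norm_sq_sub_norm_sq_eq_integral hgl hF hFg) hp
    (fun x hx => by
      have : x ∉ I := fun hxI => by rw [hI] at hxI; exact absurd hxI.1 (not_lt.2 hx)
      simp [this])
    (fun x hx => by
      have : x ∉ I := fun hxI => by rw [hI] at hxI; exact absurd hxI.2 (not_lt.2 hx)
      simp [this])
    (by
      rw [← hI]
      refine ((Lp.memLp f).integrable_norm_pow (by simp)).congr ?_
      filter_upwards [hFf] with t ht
      rw [ht])
  rw [← hlhs, hP]
  congr 1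
  · split_ifs with hbt
    · rw [boundaryValue_eq hIo hF.continuousOn hFf (hb hbt)]
    · rfl
  · split_ifs with hat
    · rw [boundaryValue_eq hIo hF.continuousOn hFf (ha hat)]
    · rfl

end Edge

/-! ### Integration by parts on the graph -/

namespace MetricGraph

variable {V E : Type*} (Γ : MetricGraph V E) {𝕜 : Type*} [RCLike 𝕜]

theorem endpoint_mem_closure {Γ : MetricGraph V E} (hΓ : 0 < ⨅ e, (Γ.b e - Γ.a e))
    (p : Γ.Endpoint) : p.elim (fun e => (Γ.a e.1).toReal) (fun e => (Γ.b e.1).toReal) ∈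
      closure (Γ.edge (p.elim Subtype.val Subtype.val)) := by
  obtain ⟨r, hr, hl⟩ := exists_length hΓ
  obtain ⟨c, hc, hp⟩ := Γ.exists_Ioo_subset hr hl p
  exact closure_mono hc (by rwa [closure_Ioo (by linarith)])

theorem inner_signedTrace_trace (hΓ : 0 < ⨅ e, (Γ.b e - Γ.a e)) (f g : Γ.W1 𝕜) :
    ⟪Γ.signedTrace hΓ f, Γ.trace hΓ g⟫_𝕜 = ⟪Γ.trace hΓ f, Γ.signedTrace hΓ g⟫_𝕜 := by
  rw [lp.inner_eq_tsum, lp.inner_eq_tsum]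
  refine tsum_congr fun p => ?_
  rcases p with e | e
  · rfl
  · change ⟪-boundaryValue _ _ _, boundaryValue _ _ _⟫_𝕜 = ⟪boundaryValue _ _ _, -boundaryValue _ _ _⟫_𝕜
    rw [inner_neg_left, inner_neg_right]

/-- The edgewise identities are summed; the sign in `str` is exactly the orientation of the boundary
terms. -/
theorem two_mul_re_inner_weakDeriv (hΓ : 0 < ⨅ e, (Γ.b e - Γ.a e)) (f : Γ.W1 𝕜) :
    2 * RCLike.re ⟪(f : Γ.Space 𝕜), Γ.weakDeriv f⟫_𝕜
      = -RCLike.re ⟪Γ.signedTrace hΓ f, Γ.trace hΓ f⟫_𝕜 := by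
  have h1 : HasSum (fun e => 2 * RCLike.re ⟪(f : Γ.Space 𝕜) e, Γ.weakDeriv f e⟫_𝕜)
      (2 * RCLike.re ⟪(f : Γ.Space 𝕜), Γ.weakDeriv f⟫_𝕜) :=
    (RCLike.hasSum_re 𝕜 (lp.hasSum_inner _ _)).mul_left 2
  have h2 := RCLike.hasSum_re 𝕜 (lp.hasSum_inner (𝕜 := 𝕜) (Γ.signedTrace hΓ f) (Γ.trace hΓ f))
  have hl : ∀ e : {e : E // ⊥ < Γ.a e},
      RCLike.re ⟪Γ.signedTrace hΓ f (.inl e), Γ.trace hΓ f (.inl e)⟫_𝕜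
        = ‖boundaryValue (Γ.edge e) ((f : Γ.Space 𝕜) e) (Γ.a e).toReal‖ ^ 2 := fun e => by
    change RCLike.re ⟪boundaryValue _ _ _, boundaryValue _ _ _⟫_𝕜 = _
    rw [inner_self_eq_norm_sq (𝕜 := 𝕜)]
  have hr : ∀ e : {e : E // Γ.b e < ⊤},
      RCLike.re ⟪Γ.signedTrace hΓ f (.inr e), Γ.trace hΓ f (.inr e)⟫_𝕜
        = -‖boundaryValue (Γ.edge e) ((f : Γ.Space 𝕜) e) (Γ.b e).toReal‖ ^ 2 := fun e => by
    change RCLike.re ⟪-boundaryValue _ _ _, boundaryValue _ _ _⟫_𝕜 = _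
    rw [inner_neg_left, map_neg, inner_self_eq_norm_sq (𝕜 := 𝕜)]
  have hsl := h2.summable.comp_injective Sum.inl_injective
  have hsr := h2.summable.comp_injective Sum.inr_injective
  have h3 : HasSum (fun p : Γ.Endpoint =>
      RCLike.re ⟪Γ.signedTrace hΓ f p, Γ.trace hΓ f p⟫_𝕜) _ := HasSum.sum hsl.hasSum hsr.hasSum
  rw [h2.unique h3]
  replace hsl := hsl.hasSum
  replace hsr := hsr.hasSum
  simp_rw [Function.comp_def, hl] at hsl
  simp_rw [Function.comp_def, hr] at hsr
  -- The sums over left and right endpoints become sums over all edges after extension by zero,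
  -- matching the `if` terms of the edgewise formula.
  have e1 := hasSum_subtype_iff_indicator (s := {e : E | ⊥ < Γ.a e})
    (f := fun e => ‖boundaryValue (Γ.edge e) ((f : Γ.Space 𝕜) e) (Γ.a e).toReal‖ ^ 2).1 hsl
  have e2 := hasSum_subtype_iff_indicator (s := {e : E | Γ.b e < ⊤})
    (f := fun e => -‖boundaryValue (Γ.edge e) ((f : Γ.Space 𝕜) e) (Γ.b e).toReal‖ ^ 2).1 hsr
  simp_rw [Function.comp_def, hl, hr]
  suffices he : (fun e => 2 * RCLike.re ⟪(f : Γ.Space 𝕜) e, Γ.weakDeriv f e⟫_𝕜) = _ from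
    h1.unique (he ▸ (e1.add e2).neg)
  funext e
  refine (two_mul_re_inner_eq_boundary (I := Γ.edge e) (Γ.a_lt_b e) rfl (Γ.hasWeakDeriv_weakDeriv f e)
    (fun h => endpoint_mem_closure hΓ (.inl ⟨e, h⟩))
    (fun h => endpoint_mem_closure hΓ (.inr ⟨e, h⟩))).trans ?_
  simp only [indicator_apply, mem_ofPred_eq]
  split_ifs <;> ring

/-- Polarisation: the quadratic identity for `f + g`, `f` and `g` gives the real part, because the
boundary form is Hermitian. -/
theorem inner_weakDeriv_add (hΓ : 0 < ⨅ e, (Γ.b e - Γ.a e)) (f g : Γ.W1 𝕜) :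
    ⟪Γ.weakDeriv f, (g : Γ.Space 𝕜)⟫_𝕜 + ⟪(f : Γ.Space 𝕜), Γ.weakDeriv g⟫_𝕜
      = -⟪Γ.signedTrace hΓ f, Γ.trace hΓ g⟫_𝕜 := by
  have hre : ∀ f g : Γ.W1 𝕜, RCLike.re (⟪Γ.weakDeriv f, (g : Γ.Space 𝕜)⟫_𝕜
      + ⟪(f : Γ.Space 𝕜), Γ.weakDeriv g⟫_𝕜 + ⟪Γ.signedTrace hΓ f, Γ.trace hΓ g⟫_𝕜) = 0 := by
    intro f g
    have h1 := Γ.two_mul_re_inner_weakDeriv hΓ (f + g)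
    have h2 := Γ.two_mul_re_inner_weakDeriv hΓ f
    have h3 := Γ.two_mul_re_inner_weakDeriv hΓ g
    have h4 : RCLike.re ⟪Γ.signedTrace hΓ g, Γ.trace hΓ f⟫_𝕜
        = RCLike.re ⟪Γ.signedTrace hΓ f, Γ.trace hΓ g⟫_𝕜 := by
      rw [inner_signedTrace_trace, inner_re_symm (𝕜 := 𝕜)]
    have h5 : RCLike.re ⟪Γ.weakDeriv f, (g : Γ.Space 𝕜)⟫_𝕜
        = RCLike.re ⟪(g : Γ.Space 𝕜), Γ.weakDeriv f⟫_𝕜 := inner_re_symm (𝕜 := 𝕜) _ _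
    simp only [map_add, Submodule.coe_add, inner_add_left, inner_add_right] at h1 ⊢
    linarith
  have hz := hre f g
  -- Replacing `f` by `I • f` yields the imaginary part. Over `ℝ` the element `I` is `0` and there
  -- is nothing to prove.
  have hI := hre ((RCLike.I : 𝕜) • f : Γ.W1 𝕜) g
  rw [map_smul, map_smul, Submodule.coe_smul, inner_smul_left, inner_smul_left, inner_smul_left,
    ← mul_add, ← mul_add, RCLike.conj_I, neg_mul, map_neg, RCLike.I_mul_re, neg_neg] at hI
  exact eq_neg_of_add_eq_zero_left (RCLike.ext (by simpa using hz) (by simpa using hI))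

end MetricGraph

/-! ### Test functions as elements of `L₂` -/

section TestFunction

variable {𝕜 : Type*} [RCLike 𝕜] {I : Set ℝ} {φ : ℝ → ℝ}

open Classical in
/-- The class of the restriction to `I` of a function `φ ∈ L₂`; the value `0` is assigned to all
other functions. -/
noncomputable def toL2 (𝕜 : Type*) [RCLike 𝕜] (I : Set ℝ) (φ : ℝ → ℝ) :
    Lp 𝕜 2 (volume.restrict I) :=
  if h : MemLp (fun x => (φ x : 𝕜)) 2 (volume.restrict I) then h.toLp else 0

theorem memLp_ofReal_of_hasCompactSupport (hφ : Continuous φ) (hc : HasCompactSupport φ) :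
    MemLp (fun x => (φ x : 𝕜)) 2 (volume.restrict I) :=
  ((hφ.memLp_of_hasCompactSupport hc).restrict I).ofReal

theorem coeFn_toL2 (hφ : Continuous φ) (hc : HasCompactSupport φ) :
    toL2 𝕜 I φ =ᵐ[volume.restrict I] fun x => (φ x : 𝕜) := by
  rw [toL2, dif_pos (memLp_ofReal_of_hasCompactSupport hφ hc)]
  exact MemLp.coeFn_toLp _

theorem inner_toL2 (hφ : Continuous φ) (hc : HasCompactSupport φ)
    (f : Lp 𝕜 2 (volume.restrict I)) : ⟪toL2 𝕜 I φ, f⟫_𝕜 = ∫ x in I, φ x • f x := by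
  rw [L2.inner_def]
  refine integral_congr_ae ?_
  filter_upwards [coeFn_toL2 (𝕜 := 𝕜) hφ hc] with x hx
  rw [hx, RCLike.inner_apply, RCLike.conj_ofReal, RCLike.real_smul_eq_coe_mul, mul_comm]

/-- Conditions of this form are closed in `(f, g)`; this is how the weak derivative is seen to have
a closed graph. -/
theorem isWeakDeriv_iff_inner {f g : Lp 𝕜 2 (volume.restrict I)} :
    IsWeakDeriv I f g ↔ ∀ φ : ℝ → ℝ, ContDiff ℝ ∞ φ → HasCompactSupport φ → tsupport φ ⊆ I →
      ⟪toL2 𝕜 I (deriv φ), f⟫_𝕜 = -⟪toL2 𝕜 I φ, g⟫_𝕜 := by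
  refine forall₄_congr fun φ h1 h2 h3 => ?_
  rw [inner_toL2 (h1.continuous_deriv (by simp)) h2.deriv, inner_toL2 h1.continuous h2]

theorem norm_toL2_sq_le (hφ : Continuous φ) (hc : HasCompactSupport φ) :
    ‖toL2 𝕜 I φ‖ ^ 2 ≤ ∫ x, φ x ^ 2 := by
  have h : ∫ x in I, ‖toL2 𝕜 I φ x‖ ^ 2 = ∫ x in I, φ x ^ 2 := by
    refine integral_congr_ae ?_
    filter_upwards [coeFn_toL2 (𝕜 := 𝕜) hφ hc] with x hx
    rw [hx, RCLike.norm_ofReal, sq_abs]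
  rw [norm_sq_eq, h]
  have hi : Integrable (fun x => φ x ^ 2) := (hφ.memLp_of_hasCompactSupport hc).integrable_sq
  exact setIntegral_le_integral hi (Eventually.of_forall fun x => sq_nonneg _)

/-- The classical derivative of a test function is its weak derivative. -/
theorem isWeakDeriv_toL2 (h1 : ContDiff ℝ ∞ φ) (h2 : HasCompactSupport φ) :
    IsWeakDeriv I (toL2 𝕜 I φ) (toL2 𝕜 I (deriv φ)) := by
  intro ψ k1 k2 k3
  have hd := h1.continuous_deriv (by simp)
  have kd := k1.continuous_deriv (by simp)
  have e : ∀ {χ θ : ℝ → ℝ}, Continuous θ → HasCompactSupport θ → tsupport χ ⊆ I →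
      ∫ x in I, χ x • toL2 𝕜 I θ x = ((∫ x, θ x * χ x : ℝ) : 𝕜) := fun {χ θ} hθ hc hχ => by
    rw [← integral_ofReal,
      ← setIntegral_eq_integral_of_forall_compl_eq_zero (s := I)
        (f := fun x => ((θ x * χ x : ℝ) : 𝕜))]
    · refine integral_congr_ae ?_
      filter_upwards [coeFn_toL2 (𝕜 := 𝕜) (I := I) hθ hc] with x hx
      rw [hx, RCLike.real_smul_eq_coe_mul, RCLike.ofReal_mul, mul_comm]
    · intro x hx
      rw [image_eq_zero_of_notMem_tsupport fun h => hx (hχ h), mul_zero, RCLike.ofReal_zero]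
  rw [e h1.continuous h2 (tsupport_deriv_subset.trans k3), e hd h2.deriv k3,
    integral_mul_deriv_eq_deriv_mul_of_integrable
      (fun x _ => (h1.differentiable (by simp) x).hasDerivAt)
      (fun x _ => (k1.differentiable (by simp) x).hasDerivAt)
      ((h1.continuous.mul kd).integrable_of_hasCompactSupport h2.mul_right)
      ((hd.mul k1.continuous).integrable_of_hasCompactSupport k2.mul_left)
      ((h1.continuous.mul k1.continuous).integrable_of_hasCompactSupport h2.mul_right),
    RCLike.ofReal_neg]

end TestFunction

/-- `ρ` is a smooth function with support in `(-r, r)`. -/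
structure IsBump (r : ℝ) (ρ : ℝ → ℝ) : Prop where
  contDiff : ContDiff ℝ ∞ ρ
  tsupport_subset : tsupport ρ ⊆ Ioo (-r) r

namespace IsBump

variable {r : ℝ} {ρ : ℝ → ℝ}

theorem hasCompactSupport (h : IsBump r ρ) : HasCompactSupport ρ :=
  isCompact_Icc.of_isClosed_subset (isClosed_tsupport ρ)
    (h.tsupport_subset.trans Ioo_subset_Icc_self)

theorem eq_zero (h : IsBump r ρ) {x : ℝ} (hx : r ≤ x) : ρ x = 0 :=
  image_eq_zero_of_notMem_tsupport fun h' => (h.tsupport_subset h').2.not_ge hx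

theorem neg (h : IsBump r ρ) : IsBump r (fun x => -ρ x) :=
  ⟨h.contDiff.neg, by
    have : tsupport (fun x => -ρ x) = tsupport ρ := by
      unfold tsupport; congr 1; ext x; simp
    rw [this]; exact h.tsupport_subset⟩

theorem deriv (h : IsBump r ρ) : IsBump r (deriv ρ) :=
  ⟨(contDiff_infty_iff_deriv.1 h.contDiff).2, tsupport_deriv_subset.trans h.tsupport_subset⟩

theorem id_mul (h : IsBump r ρ) : IsBump r (fun x => x * ρ x) :=
  ⟨contDiff_id.mul h.contDiff, (tsupport_mul_subset_right).trans h.tsupport_subset⟩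

theorem hasCompactSupport_sub_const (h : IsBump r ρ) (z : ℝ) :
    HasCompactSupport fun x => ρ (x - z) :=
  h.hasCompactSupport.comp_homeomorph (Homeomorph.subRight z)

theorem hasCompactSupport_const_sub (h : IsBump r ρ) (z : ℝ) :
    HasCompactSupport fun x => ρ (z - x) :=
  h.hasCompactSupport.comp_homeomorph (Homeomorph.subLeft z)

theorem contDiff_sub_const (h : IsBump r ρ) (z : ℝ) : ContDiff ℝ ∞ fun x => ρ (x - z) :=
  h.contDiff.comp (contDiff_id.sub contDiff_const)

theorem contDiff_const_sub (h : IsBump r ρ) (z : ℝ) : ContDiff ℝ ∞ fun x => ρ (z - x) :=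
  h.contDiff.comp (contDiff_const.sub contDiff_id)

end IsBump

/-- A bump with a plateau around `0`, which makes its derivative vanish there. -/
theorem exists_isBump {r : ℝ} (hr : 0 < r) :
    ∃ ρ : ℝ → ℝ, IsBump r ρ ∧ ρ 0 = 1 ∧ deriv ρ 0 = 0 := by
  let B : ContDiffBump (0 : ℝ) := ⟨r / 4, r / 2, by positivity, by linarith⟩
  refine ⟨B, ⟨B.contDiff, ?_⟩, ?_, ?_⟩
  · rw [B.tsupport_eq, Real.closedBall_eq_Icc]
    refine (Icc_subset_Ioo ?_ ?_) <;> simp only [B] <;> linarith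
  · exact B.one_of_mem_closedBall (Metric.mem_closedBall_self B.rIn_pos.le)
  · have h : B =ᶠ[𝓝 (0 : ℝ)] fun _ => (1 : ℝ) :=
      B.eventuallyEq_one_of_mem_ball (Metric.mem_ball_self B.rIn_pos)
    rw [h.deriv_eq, deriv_const]

/-! ### Extension of boundary data to the edges by bumps -/

namespace MetricGraph

variable {V E : Type*} (Γ : MetricGraph V E) {𝕜 : Type*} [RCLike 𝕜] {r : ℝ} {ρ σ : ℝ → ℝ}

open Classical in
/-- The extension by `0` of `β` on the left endpoints. -/
noncomputable def leftCoeff (β : Γ.BoundarySpace 𝕜) (e : E) : 𝕜 :=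
  if h : ⊥ < Γ.a e then β (.inl ⟨e, h⟩) else 0

open Classical in
/-- The extension by `0` of `β` on the right endpoints. -/
noncomputable def rightCoeff (β : Γ.BoundarySpace 𝕜) (e : E) : 𝕜 :=
  if h : Γ.b e < ⊤ then β (.inr ⟨e, h⟩) else 0

theorem hasSum_coeff (β : Γ.BoundarySpace 𝕜) :
    HasSum (fun e => ‖Γ.leftCoeff β e‖ ^ 2 + ‖Γ.rightCoeff β e‖ ^ 2) (‖β‖ ^ 2) := by
  have h : HasSum (fun p => ‖β p‖ ^ 2) (‖β‖ ^ 2) := by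
    simpa using lp.hasSum_norm (p := 2) (by simp) β
  have hl := (h.summable.comp_injective Sum.inl_injective).hasSum
  have hr := (h.summable.comp_injective Sum.inr_injective).hasSum
  rw [h.unique (HasSum.sum hl hr)]
  have el : ∀ e : {e : E // ⊥ < Γ.a e}, ‖β (.inl e)‖ ^ 2 = ‖Γ.leftCoeff β e‖ ^ 2 := fun e => by
    rw [leftCoeff, dif_pos e.2]
  have er : ∀ e : {e : E // Γ.b e < ⊤}, ‖β (.inr e)‖ ^ 2 = ‖Γ.rightCoeff β e‖ ^ 2 := fun e => by
    rw [rightCoeff, dif_pos e.2]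
  simp_rw [Function.comp_def, el] at hl ⊢
  simp_rw [Function.comp_def, er] at hr ⊢
  refine HasSum.add ((hasSum_subtype_iff_of_support_subset (s := {e : E | ⊥ < Γ.a e})
      (f := fun e => ‖Γ.leftCoeff β e‖ ^ 2) ?_).1 hl)
    ((hasSum_subtype_iff_of_support_subset (s := {e : E | Γ.b e < ⊤})
      (f := fun e => ‖Γ.rightCoeff β e‖ ^ 2) ?_).1 hr)
  · intro e he
    by_contra h
    exact he (by change ‖Γ.leftCoeff β e‖ ^ 2 = 0; rw [leftCoeff, dif_neg (show ¬⊥ < Γ.a e from h)]; simp)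
  · intro e he
    by_contra h
    exact he (by change ‖Γ.rightCoeff β e‖ ^ 2 = 0; rw [rightCoeff, dif_neg (show ¬Γ.b e < ⊤ from h)]; simp)

/-- The function on the edge `e` that is given by `β (e, 0) ρ (x - aₑ)` near `aₑ` and by
`β (e, 1) σ (bₑ - x)` near `bₑ`. -/
noncomputable def edgeExtension (ρ σ : ℝ → ℝ) (β : Γ.BoundarySpace 𝕜) (e : E) :
    Lp 𝕜 2 (volume.restrict (Γ.edge e)) :=
  Γ.leftCoeff β e • toL2 𝕜 (Γ.edge e) (fun x => ρ (x - (Γ.a e).toReal)) +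
    Γ.rightCoeff β e • toL2 𝕜 (Γ.edge e) (fun x => σ ((Γ.b e).toReal - x))

theorem norm_edgeExtension_sq_le (hρ : IsBump r ρ) (hσ : IsBump r σ) (β : Γ.BoundarySpace 𝕜)
    (e : E) : ‖Γ.edgeExtension ρ σ β e‖ ^ 2 ≤ 2 * ((∫ x, ρ x ^ 2) + ∫ x, σ x ^ 2) *
      (‖Γ.leftCoeff β e‖ ^ 2 + ‖Γ.rightCoeff β e‖ ^ 2) := by
  have h1 := norm_toL2_sq_le (𝕜 := 𝕜) (I := Γ.edge e)
    (hρ.contDiff_sub_const (Γ.a e).toReal).continuous (hρ.hasCompactSupport_sub_const _)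
  have h2 := norm_toL2_sq_le (𝕜 := 𝕜) (I := Γ.edge e)
    (hσ.contDiff_const_sub (Γ.b e).toReal).continuous (hσ.hasCompactSupport_const_sub _)
  -- Invariance under translation and reflection makes the bound independent of the edge.
  rw [integral_sub_right_eq_self (fun x => ρ x ^ 2)] at h1
  rw [integral_sub_left_eq_self (fun x => σ x ^ 2)] at h2
  rw [edgeExtension]
  set u := toL2 𝕜 (Γ.edge e) fun x => ρ (x - (Γ.a e).toReal)
  set v := toL2 𝕜 (Γ.edge e) fun x => σ ((Γ.b e).toReal - x)
  have hn := norm_add_le (Γ.leftCoeff β e • u) (Γ.rightCoeff β e • v)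
  rw [norm_smul, norm_smul] at hn
  have hu := sq_nonneg ‖u‖
  have hv := sq_nonneg ‖v‖
  calc _ ≤ (‖Γ.leftCoeff β e‖ * ‖u‖ + ‖Γ.rightCoeff β e‖ * ‖v‖) ^ 2 := by gcongr
    _ ≤ 2 * (‖Γ.leftCoeff β e‖ ^ 2 * ‖u‖ ^ 2 + ‖Γ.rightCoeff β e‖ ^ 2 * ‖v‖ ^ 2) := by
      nlinarith [sq_nonneg (‖Γ.leftCoeff β e‖ * ‖u‖ - ‖Γ.rightCoeff β e‖ * ‖v‖)]
    _ ≤ 2 * (‖Γ.leftCoeff β e‖ ^ 2 * ((∫ x, ρ x ^ 2) + ∫ x, σ x ^ 2)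
        + ‖Γ.rightCoeff β e‖ ^ 2 * ((∫ x, ρ x ^ 2) + ∫ x, σ x ^ 2)) := by
      gcongr <;> linarith
    _ = _ := by ring

theorem exists_extension (hρ : IsBump r ρ) (hσ : IsBump r σ) (β : Γ.BoundarySpace 𝕜) :
    ∃ f : Γ.Space 𝕜, (∀ e, f e = Γ.edgeExtension ρ σ β e) ∧
      ‖f‖ ≤ √(2 * ((∫ x, ρ x ^ 2) + ∫ x, σ x ^ 2)) * ‖β‖ := by
  have hs := (Γ.hasSum_coeff β).mul_left (2 * ((∫ x, ρ x ^ 2) + ∫ x, σ x ^ 2))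
  have hS : Summable fun e => ‖Γ.edgeExtension ρ σ β e‖ ^ 2 :=
    Summable.of_nonneg_of_le (fun e => sq_nonneg _)
      (fun e => Γ.norm_edgeExtension_sq_le hρ hσ β e) hs.summable
  let f : Γ.Space 𝕜 := ⟨fun e => Γ.edgeExtension ρ σ β e, memℓp_gen (by simpa using hS)⟩
  refine ⟨f, fun e => rfl, ?_⟩
  have hf : HasSum (fun e => ‖f e‖ ^ 2) (‖f‖ ^ 2) := by
    simpa using lp.hasSum_norm (p := 2) (by simp) f
  have h := hasSum_le (fun e => Γ.norm_edgeExtension_sq_le hρ hσ β e) hf hs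
  rw [← Real.sqrt_sq (norm_nonneg β), ← Real.sqrt_mul' _ (sq_nonneg _)]
  exact Real.le_sqrt_of_sq_le h

/-- Differentiation keeps the form of an extension, but `σ (b - x)` acquires a sign. This is why the
two ends carry separate profiles. -/
theorem isWeakDeriv_edgeExtension (hρ : IsBump r ρ) (hσ : IsBump r σ) (β : Γ.BoundarySpace 𝕜)
    (e : E) : IsWeakDeriv (Γ.edge e) (Γ.edgeExtension ρ σ β e)
      (Γ.edgeExtension (deriv ρ) (fun x => -deriv σ x) β e) := by
  have h1 := isWeakDeriv_toL2 (𝕜 := 𝕜) (I := Γ.edge e)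
    (hρ.contDiff_sub_const (Γ.a e).toReal) (hρ.hasCompactSupport_sub_const _)
  have h2 := isWeakDeriv_toL2 (𝕜 := 𝕜) (I := Γ.edge e)
    (hσ.contDiff_const_sub (Γ.b e).toReal) (hσ.hasCompactSupport_const_sub _)
  have e1 : deriv (fun x => ρ (x - (Γ.a e).toReal)) = fun x => deriv ρ (x - (Γ.a e).toReal) :=
    funext fun x => deriv_comp_sub_const ..
  have e2 : deriv (fun x => σ ((Γ.b e).toReal - x)) = fun x => -deriv σ ((Γ.b e).toReal - x) :=
    funext fun x => deriv_comp_const_sub ..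
  rw [e1] at h1
  rw [e2] at h2
  exact (h1.smul _).add (h2.smul _)

theorem boundaryValue_edgeExtension (hρ : IsBump r ρ) (hσ : IsBump r σ) (β : Γ.BoundarySpace 𝕜)
    (e : E) {z : ℝ} (hz : z ∈ closure (Γ.edge e)) :
    boundaryValue (Γ.edge e) (Γ.edgeExtension ρ σ β e) z
      = Γ.leftCoeff β e * (ρ (z - (Γ.a e).toReal) : ℝ)
        + Γ.rightCoeff β e * (σ ((Γ.b e).toReal - z) : ℝ) := by
  have c1 := (hρ.contDiff_sub_const (Γ.a e).toReal).continuous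
  have c2 := (hσ.contDiff_const_sub (Γ.b e).toReal).continuous
  have k1 := hρ.hasCompactSupport_sub_const (Γ.a e).toReal
  have k2 := hσ.hasCompactSupport_const_sub (Γ.b e).toReal
  refine boundaryValue_eq (Γ.isOpen_edge e)
    (F := fun z => Γ.leftCoeff β e * (ρ (z - (Γ.a e).toReal) : ℝ)
        + Γ.rightCoeff β e * (σ ((Γ.b e).toReal - z) : ℝ)) ?_ ?_ hz
  · exact ((continuous_const.mul (RCLike.continuous_ofReal.comp c1)).add
      (continuous_const.mul (RCLike.continuous_ofReal.comp c2))).continuousOn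
  · filter_upwards [Lp.coeFn_add (Γ.leftCoeff β e • toL2 𝕜 (Γ.edge e) fun x =>
        ρ (x - (Γ.a e).toReal)) (Γ.rightCoeff β e • toL2 𝕜 (Γ.edge e) fun x =>
        σ ((Γ.b e).toReal - x)),
      Lp.coeFn_smul (Γ.leftCoeff β e) (toL2 𝕜 (Γ.edge e) fun x => ρ (x - (Γ.a e).toReal)),
      Lp.coeFn_smul (Γ.rightCoeff β e) (toL2 𝕜 (Γ.edge e) fun x => σ ((Γ.b e).toReal - x)),
      coeFn_toL2 (𝕜 := 𝕜) (I := Γ.edge e) c1 k1, coeFn_toL2 (𝕜 := 𝕜) (I := Γ.edge e) c2 k2]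
      with x h1 h2 h3 h4 h5
    rw [edgeExtension, h1, Pi.add_apply, h2, h3, Pi.smul_apply, Pi.smul_apply, h4, h5,
      smul_eq_mul, smul_eq_mul]

variable {Γ}

/-- Every edge has length at least `r` and the profiles vanish from distance `r` on, so at each
endpoint only its own bump contributes. -/
theorem boundaryValues_extension (hΓ : 0 < ⨅ e, (Γ.b e - Γ.a e))
    (hl : ∀ e, (r : EReal) ≤ Γ.b e - Γ.a e) (hρ : IsBump r ρ)
    (hσ : IsBump r σ) {β : Γ.BoundarySpace 𝕜} {f : Γ.Space 𝕜}
    (hf : ∀ e, f e = Γ.edgeExtension ρ σ β e) (p : Γ.Endpoint) :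
    Γ.boundaryValues f p = β p * (p.elim (fun _ => ρ 0) (fun _ => σ 0) : ℝ) := by
  have hlen : ∀ e, ⊥ < Γ.a e → Γ.b e < ⊤ → r ≤ (Γ.b e).toReal - (Γ.a e).toReal := by
    intro e ha hb
    have := hl e
    rw [← EReal.coe_toReal hb.ne (ne_bot_of_gt (Γ.a_lt_b e)),
      ← EReal.coe_toReal (ne_top_of_lt (Γ.a_lt_b e)) ha.ne'] at this
    exact_mod_cast this
  rcases p with ⟨e, he⟩ | ⟨e, he⟩
  · have hcl : (Γ.a e).toReal ∈ closure (Γ.edge e) := endpoint_mem_closure hΓ (.inl ⟨e, he⟩)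
    change boundaryValue (Γ.edge e) (f e) (Γ.a e).toReal = _
    rw [hf, Γ.boundaryValue_edgeExtension hρ hσ β e hcl, sub_self, leftCoeff, dif_pos he]
    by_cases hb : Γ.b e < ⊤
    · rw [hσ.eq_zero (hlen e he hb)]; simp
    -- At an infinite end `toReal` returns the meaningless centre `0`, but the coefficient there is
    -- `0`.
    · rw [rightCoeff, dif_neg hb]; simp
  · have hcl : (Γ.b e).toReal ∈ closure (Γ.edge e) := endpoint_mem_closure hΓ (.inr ⟨e, he⟩)
    change boundaryValue (Γ.edge e) (f e) (Γ.b e).toReal = _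
    rw [hf, Γ.boundaryValue_edgeExtension hρ hσ β e hcl, sub_self, rightCoeff, dif_pos he]
    by_cases ha : ⊥ < Γ.a e
    · rw [hρ.eq_zero (hlen e ha he)]; simp
    · rw [leftCoeff, dif_neg ha]; simp

end MetricGraph

section InnerProductSpace

variable {𝕜 F : Type*} [RCLike 𝕜] [NormedAddCommGroup F] [InnerProductSpace 𝕜 F]

theorem inner_neg_sub_inner_neg_eq {u v a b x y : F} {s t : 𝕜}
    (h1 : ⟪u, v⟫_𝕜 + ⟪a, b⟫_𝕜 = -s) (h2 : ⟪a, b⟫_𝕜 + ⟪x, y⟫_𝕜 = -t) :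
    ⟪-u, v⟫_𝕜 - ⟪x, -y⟫_𝕜 = s - t := by
  rw [inner_neg_left, inner_neg_right]
  linear_combination h2 - h1

theorem eq_zero_of_inner_eq_inner_sub {f f' g g' h : F} {s : 𝕜} (h1 : ⟪g', f'⟫_𝕜 = ⟪g, h - f⟫_𝕜)
    (h2 : ⟪f - h, g⟫_𝕜 + ⟪f', g'⟫_𝕜 = -s) : s = 0 := by
  rw [← inner_conj_symm f', h1, inner_conj_symm, ← inner_add_left, sub_add_sub_cancel, sub_self,
    inner_zero_left] at h2
  exact neg_eq_zero.1 h2.symm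

end InnerProductSpace

/-! ### The boundary triple of the maximal Laplacian -/

namespace MetricGraph

variable {V E : Type*} {Γ : MetricGraph V E} {𝕜 : Type*} [RCLike 𝕜]

theorem maximalLaplacian_apply (F : (Γ.maximalLaplacian 𝕜).domain) :
    Γ.maximalLaplacian 𝕜 F = -Γ.weakDeriv (Γ.firstDeriv F) := rfl

theorem exists_mem_W2 {f g k : Γ.Space 𝕜} (hfg : Γ.HasWeakDeriv f g) (hgk : Γ.HasWeakDeriv g k) :
    ∃ F : (Γ.maximalLaplacian 𝕜).domain, (F : Γ.Space 𝕜) = f ∧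
      (Γ.firstDeriv F : Γ.Space 𝕜) = g ∧ Γ.maximalLaplacian 𝕜 F = -k := by
  have h1 : Γ.weakDeriv ⟨f, g, hfg⟩ = g := (Γ.hasWeakDeriv_weakDeriv ⟨f, g, hfg⟩).unique hfg
  have hf : f ∈ Γ.W2 𝕜 := ⟨⟨f, g, hfg⟩, by
    change Γ.weakDeriv ⟨f, g, hfg⟩ ∈ Γ.W1 𝕜
    rw [h1]; exact ⟨k, hgk⟩, rfl⟩
  have h2 : (Γ.firstDeriv ⟨f, hf⟩ : Γ.Space 𝕜) = g := h1
  refine ⟨⟨f, hf⟩, rfl, h2, ?_⟩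
  have h3 := Γ.hasWeakDeriv_weakDeriv (Γ.firstDeriv ⟨f, hf⟩)
  rw [h2] at h3
  exact congrArg Neg.neg (h3.unique hgk)

theorem hasWeakDeriv_iff_inner_single [DecidableEq E] {f g : Γ.Space 𝕜} :
    Γ.HasWeakDeriv f g ↔ ∀ (e : E) (φ : ℝ → ℝ), ContDiff ℝ ∞ φ → HasCompactSupport φ →
      tsupport φ ⊆ Γ.edge e → ⟪(lp.single 2 e (toL2 𝕜 (Γ.edge e) (deriv φ)) : Γ.Space 𝕜), f⟫_𝕜
        = -⟪(lp.single 2 e (toL2 𝕜 (Γ.edge e) φ) : Γ.Space 𝕜), g⟫_𝕜 := by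
  simp_rw [lp.inner_single_left]
  exact forall_congr' fun e => isWeakDeriv_iff_inner

theorem hasWeakDeriv_single [DecidableEq E] (e : E) {φ : ℝ → ℝ} (h1 : ContDiff ℝ ∞ φ)
    (h2 : HasCompactSupport φ) :
    Γ.HasWeakDeriv (lp.single 2 e (toL2 𝕜 (Γ.edge e) φ) : Γ.Space 𝕜)
      (lp.single 2 e (toL2 𝕜 (Γ.edge e) (deriv φ)) : Γ.Space 𝕜) := by
  intro e'
  by_cases he : e' = e
  · subst he
    rw [lp.single_apply_self, lp.single_apply_self]
    exact isWeakDeriv_toL2 h1 h2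
  · rw [lp.single_apply_ne _ _ _ he, lp.single_apply_ne _ _ _ he]
    exact isWeakDeriv_iff_inner.2 fun φ _ _ _ => by simp

variable (Γ 𝕜) in
/-- The graph of the weak derivative. -/
noncomputable def derivGraph : Submodule 𝕜 (WithLp 2 (Γ.Space 𝕜 × Γ.Space 𝕜)) where
  carrier := {p | Γ.HasWeakDeriv p.fst p.snd}
  add_mem' h h' := HasWeakDeriv.add h h'
  zero_mem' := fun _ => isWeakDeriv_iff_inner.2 fun φ _ _ _ => by simp
  smul_mem' c _ h := HasWeakDeriv.smul c h

theorem isClosed_derivGraph :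
    IsClosed (Γ.derivGraph 𝕜 : Set (WithLp 2 (Γ.Space 𝕜 × Γ.Space 𝕜))) := by
  classical
  have : (Γ.derivGraph 𝕜 : Set (WithLp 2 (Γ.Space 𝕜 × Γ.Space 𝕜)))
      = {p | Γ.HasWeakDeriv p.fst p.snd} := rfl
  simp_rw [this, hasWeakDeriv_iff_inner_single, ofPred_forall]
  refine isClosed_iInter fun e => isClosed_iInter fun φ => isClosed_iInter fun _ =>
    isClosed_iInter fun _ => isClosed_iInter fun _ => isClosed_eq ?_ ?_
  · exact continuous_const.inner (WithLp.prod_continuous_ofLp 2 _ _).fst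
  · exact (continuous_const.inner (WithLp.prod_continuous_ofLp 2 _ _).snd).neg

/-- The pair `(f, f')` is the orthogonal projection of `(h, 0)` onto the closed graph of the weak
derivative. Orthogonality of the remainder `(h - f, -f')` to this graph is the weak form of the
Neumann problem. -/
theorem exists_weak_solution (h : Γ.Space 𝕜) : ∃ f f' : Γ.Space 𝕜, Γ.HasWeakDeriv f f' ∧
    ∀ g g' : Γ.Space 𝕜, Γ.HasWeakDeriv g g' → ⟪g', f'⟫_𝕜 = ⟪g, h - f⟫_𝕜 := by
  have : CompleteSpace (Γ.derivGraph 𝕜) := isClosed_derivGraph.completeSpace_coe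
  obtain ⟨p, hp, q, hq, hpq⟩ :=
    (Γ.derivGraph 𝕜).exists_add_mem_mem_orthogonal (WithLp.toLp 2 (h, (0 : Γ.Space 𝕜)))
  have h1 : q.fst = h - p.fst := eq_sub_of_add_eq' (congrArg WithLp.fst hpq).symm
  have h2 : q.snd = -p.snd := eq_neg_of_add_eq_zero_right (congrArg WithLp.snd hpq).symm
  refine ⟨p.fst, p.snd, hp, fun g g' hg => ?_⟩
  have := hq (WithLp.toLp 2 (g, g')) hg
  rw [WithLp.prod_inner_apply] at this
  change ⟪g, q.fst⟫_𝕜 + ⟪g', q.snd⟫_𝕜 = 0 at this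
  rw [h1, h2, inner_neg_right] at this
  linear_combination -this

theorem exists_neumann_solution (hΓ : 0 < ⨅ e, (Γ.b e - Γ.a e))
    (htr : ∀ β : Γ.BoundarySpace 𝕜, ∃ g, Γ.trace hΓ g = β) (h : Γ.Space 𝕜) :
    ∃ F : (Γ.maximalLaplacian 𝕜).domain, Γ.signedTrace hΓ (Γ.firstDeriv F) = 0 ∧
      (F : Γ.Space 𝕜) + Γ.maximalLaplacian 𝕜 F = h := by
  classical
  obtain ⟨f, f', hf, hw⟩ := exists_weak_solution h
  -- Test functions supported on a single edge give `f'' = f - h`.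
  have hf' : Γ.HasWeakDeriv f' (f - h) := hasWeakDeriv_iff_inner_single.2 fun e φ h1 h2 _ => by
    rw [hw _ _ (hasWeakDeriv_single e h1 h2), ← inner_neg_right, neg_sub]
  obtain ⟨F, hF, hF', hAF⟩ := exists_mem_W2 hf hf'
  refine ⟨F, ?_, by rw [hF, hAF]; abel⟩
  -- The boundary condition is natural: testing with `g` such that `tr g = str f'` leaves `‖str f'‖²
  -- = 0` after integration by parts.
  obtain ⟨g, hg⟩ := htr (Γ.signedTrace hΓ (Γ.firstDeriv F))
  have e1 := Γ.inner_weakDeriv_add hΓ (Γ.firstDeriv F) g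
  have e2 : Γ.weakDeriv (Γ.firstDeriv F) = f - h := by
    rw [maximalLaplacian_apply] at hAF
    exact neg_injective hAF
  rw [hg, e2, hF'] at e1
  exact inner_self_eq_zero.1
    (eq_zero_of_inner_eq_inner_sub (hw _ _ (Γ.hasWeakDeriv_weakDeriv g)) e1)

/-- Integration by parts for `(f', g)` and for `(f, g')`; the common term `⟪f', g'⟫` cancels. -/
theorem greenIdentity_maximalLaplacian (hΓ : 0 < ⨅ e, (Γ.b e - Γ.a e)) :
    GreenIdentity (Γ.maximalLaplacian 𝕜) (Γ.trace hΓ ∘ₗ Γ.toW1)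
      (Γ.signedTrace hΓ ∘ₗ Γ.firstDeriv) := by
  intro f g
  have h1 := Γ.inner_weakDeriv_add hΓ (Γ.firstDeriv f) (Γ.toW1 g)
  have h2 := Γ.inner_weakDeriv_add hΓ (Γ.toW1 f) (Γ.firstDeriv g)
  rw [inner_signedTrace_trace] at h2
  exact inner_neg_sub_inner_neg_eq h1 h2

/-- The same profile is used at both ends in the inward coordinate. As `str f'` consists of inward
derivatives, both ends contribute `ρ' 0` with the same sign. -/
theorem exists_boundary_extension (hΓ : 0 < ⨅ e, (Γ.b e - Γ.a e)) {r : ℝ}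
    (hl : ∀ e, (r : EReal) ≤ Γ.b e - Γ.a e) {ρ : ℝ → ℝ} (hρ : IsBump r ρ) :
    ∃ C : ℝ, ∀ β : Γ.BoundarySpace 𝕜, ∃ F : (Γ.maximalLaplacian 𝕜).domain,
      Γ.trace hΓ (Γ.toW1 F) = ((ρ 0 : ℝ) : 𝕜) • β ∧
      Γ.signedTrace hΓ (Γ.firstDeriv F) = ((deriv ρ 0 : ℝ) : 𝕜) • β ∧
      ‖(F : Γ.Space 𝕜) + Γ.maximalLaplacian 𝕜 F‖ ≤ C * ‖β‖ := by
  have h2 : deriv (fun x => -deriv ρ x) = fun x => -deriv (deriv ρ) x := funext fun x => deriv.neg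
  refine ⟨√(2 * ((∫ x, ρ x ^ 2) + ∫ x, ρ x ^ 2)) +
    √(2 * ((∫ x, deriv (deriv ρ) x ^ 2) + ∫ x, deriv (deriv ρ) x ^ 2)), fun β => ?_⟩
  obtain ⟨f, hf, hfC⟩ := Γ.exists_extension hρ hρ β
  obtain ⟨g, hg, -⟩ := Γ.exists_extension hρ.deriv hρ.deriv.neg β
  obtain ⟨k, hk, hkC⟩ := Γ.exists_extension hρ.deriv.deriv hρ.deriv.deriv β
  have hfg : Γ.HasWeakDeriv f g := fun e => by
    rw [hf, hg]; exact Γ.isWeakDeriv_edgeExtension hρ hρ β e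
  have hgk : Γ.HasWeakDeriv g k := fun e => by
    have := Γ.isWeakDeriv_edgeExtension hρ.deriv hρ.deriv.neg β e
    simp_rw [h2, neg_neg] at this
    rw [hg, hk]; exact this
  obtain ⟨F, hF, hF', hAF⟩ := exists_mem_W2 hfg hgk
  refine ⟨F, ?_, ?_, ?_⟩
  · refine lp.ext (funext fun p => ?_)
    change Γ.boundaryValues (F : Γ.Space 𝕜) p = ((ρ 0 : ℝ) : 𝕜) * β p
    rw [hF, boundaryValues_extension hΓ hl hρ hρ hf p, mul_comm]
    cases p <;> rfl
  · refine lp.ext (funext fun p => ?_)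
    change Γ.signedBoundaryValues (Γ.firstDeriv F : Γ.Space 𝕜) p = ((deriv ρ 0 : ℝ) : 𝕜) * β p
    have := boundaryValues_extension hΓ hl hρ.deriv hρ.deriv.neg hg p
    rw [hF']
    rcases p with e | e
    · exact this.trans (mul_comm _ _)
    · refine (congrArg Neg.neg this).trans ?_
      simp [mul_comm]
  · rw [hF, hAF]
    refine (norm_add_le _ _).trans ?_
    rw [norm_neg]
    exact (add_le_add hfC hkC).trans (add_mul _ _ _).ge

/-- The plateau bump `ρ` gives the bounded extension with `tr f = β` and `str f' = 0`. The profile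
`x * ρ x` has derivative `1` at `0` and gives surjectivity of `str f'`. -/
theorem isBoundaryTriple (hΓ : 0 < ⨅ e, (Γ.b e - Γ.a e)) :
    IsBoundaryTriple (Γ.maximalLaplacian 𝕜) (Γ.trace hΓ ∘ₗ Γ.toW1)
      (Γ.signedTrace hΓ ∘ₗ Γ.firstDeriv) := by
  obtain ⟨r, hr, hl⟩ := exists_length hΓ
  obtain ⟨ρ, hρ, hρ0, hρ1⟩ := exists_isBump hr
  have hd : deriv (fun x => x * ρ x) 0 = 1 := by
    have : HasDerivAt (fun x => x * ρ x) _ 0 := (hasDerivAt_id (0 : ℝ)).mul (hρ.contDiff.differentiable (by simp) 0).hasDerivAt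
    simpa [hρ0] using this.deriv
  obtain ⟨C, hC⟩ := exists_boundary_extension (𝕜 := 𝕜) hΓ hl hρ
  obtain ⟨C', hC'⟩ := exists_boundary_extension (𝕜 := 𝕜) hΓ hl hρ.id_mul
  simp_rw [hρ0, hρ1, RCLike.ofReal_one, RCLike.ofReal_zero, one_smul, zero_smul] at hC
  simp_rw [hd, RCLike.ofReal_one, one_smul] at hC'
  refine .of_neumann (greenIdentity_maximalLaplacian hΓ)
    (fun u => (hC' u).imp fun F hF => hF.2.1)
    (exists_neumann_solution hΓ fun β => ?_) hC
  obtain ⟨F, hF, -⟩ := hC β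
  exact ⟨Γ.toW1 F, hF⟩

end MetricGraph

end QuantumGraph

/-! ### The characterisation of self-adjoint Laplacians -/

theorem mainTheorem1 {𝕜 : Type*} [RCLike 𝕜] {V E : Type*} (Γ : QuantumGraph.MetricGraph V E)
    (hΓ : 0 < ⨅ e, (Γ.b e - Γ.a e))
    (H : Γ.Space 𝕜 →ₗ.[𝕜] Γ.Space 𝕜) (hH : H ≤ Γ.maximalLaplacian 𝕜) :
    IsSelfAdjoint H ↔
      ∃ (X : Submodule 𝕜 (Γ.BoundarySpace 𝕜)) (hX : IsClosed (X : Set (Γ.BoundarySpace 𝕜))),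
        haveI : CompleteSpace X := hX.completeSpace_coe
        ∃ L : X →ₗ.[𝕜] X, IsSelfAdjoint L ∧
          (H.domain : Set (Γ.Space 𝕜)) =
            {f | ∃ (hf : f ∈ (Γ.maximalLaplacian 𝕜).domain) (x : L.domain),
              ((x : X) : Γ.BoundarySpace 𝕜) = Γ.trace hΓ (Γ.toW1 ⟨f, hf⟩) ∧
              L x = X.orthogonalProjectionOnto (Γ.signedTrace hΓ (Γ.firstDeriv ⟨f, hf⟩))} := by
  have hT := QuantumGraph.MetricGraph.isBoundaryTriple (𝕜 := 𝕜) hΓ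
  constructor
  · intro hsa
    obtain ⟨X, hX, _, L, hL, hdom⟩ := hT.exists_boundary_of_isSelfAdjoint hH hsa
    exact ⟨X, hX, L, hL, Set.ext fun f => ⟨fun hf => ⟨hH.1 hf, (hdom ⟨f, hH.1 hf⟩).1 hf⟩,
      fun ⟨hf, hx⟩ => (hdom ⟨f, hf⟩).2 hx⟩⟩
  · rintro ⟨X, hX, L, hL, hdom⟩
    have : CompleteSpace X := hX.completeSpace_coe
    refine hT.isSelfAdjoint_of_boundary hH X L hL fun f => ?_
    refine (Set.ext_iff.1 hdom f).trans ⟨?_, fun hx => ⟨f.2, hx⟩⟩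
    rintro ⟨_, hx⟩
    exact hx
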